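/- Let $R>0$, let $B\subset\mathbb{R}^3$ be the closed ball of radius $R$ centred at the origin, and let $f:\mathbb{R}^3\to\mathbb{R}$ be a $C^1$ function that vanishes outside $B$. For $z\in\partial B$ and $r\ge 0$ let $$g(z,r)=\int_{\mathbb{S}^2} f(z+r\theta)\,r^2\,ds(\theta),$$ where $ds$ is the (unnormalized) surface measure, and let $n(z)=-z/R$ be the unit normal to $\partial B$ directed into $B$. Let $j_0(t)=\sqrt{\pi/(2t)}\,J_{1/2}(t)=\frac{\sin t}{t}$ and $n_0(t)=\sqrt{\pi/(2t)}\,N_{1/2}(t)=-\frac{\cos t}{t}$ be the spherical Bessel and Neumann functions of order $0$, where $J_{1/2}$ and $N_{1/2}$ are the Bessel and Neumann functions of order $1/2$. For $z\in\partial B$ and $t>0$ let $$h(z,t)=\frac{2}{\pi}\int_0^\infty\left[n_0(\lambda t)\int_0^{2R}j_0(\lambda t')g(z,t')\,dt'-j_0(\lambda t)\int_0^{2R}n_0(\lambda t')g(z,t')\,dt'\right]\lambda^3\,d\lambda ,$$ where the integral over $\lambda$ is understood in the Abel sense, i.e. as the limit for $\varepsilon\to0^+$ of the absolutely convergent integrals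 with the additional factor $e^{-\varepsilon\lambda}$. (1) For all $z\in\partial B$ and $t>0$ this limit exists, $t\mapsto g(z,t)/t$ is differentiable at $t$, and $$h(z,t)=-\frac{2}{t}\,\frac{d}{dt}\frac{g(z,t)}{t}.$$ Moreover, if the integral over $\lambda$ converges as an improper integral $\lim_{\Lambda\to\infty}\int_0^\Lambda$, then its value is $h(z,t)$; and if $f$ is $C^2$, then it converges absolutely and its value is $h(z,t)$. (2) For every $y$ in the interior of $B$ (that is, $|y|<R$), the two vector fields of $y$ below are given by integrable integrands and are differentiable at $y$, and $$f(y)=\frac{1}{16\pi^2}\,\mathrm{div}_y\int_{\partial B}n(z)\,h(z,|y-z|)\,ds(z)=-\frac{1}{8\pi^2}\,\mathrm{div}_y\int_{\partial B}n(z)\left.\left(\frac1t\,\frac{d}{dt}\frac{g(z,t)}{t}\right)\right|_{t=|z-y|}ds(z).$$ -/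

import Mathlib

open MeasureTheory Filter Topology Set

noncomputable section

namespace SphMean

/-- Euclidean three-space. -/
abbrev E3 : Type := EuclideanSpace ℝ (Fin 3)

/-- The standard surface measure on the unit sphere of `E3` (total mass `4 * π`). -/
def sigma : Measure (Metric.sphere (0 : E3) 1) := (volume : Measure E3).toSphere

/-- Spherical integrals: `sphInt f z r` is the integral over the unit sphere of
`f (z + r * θ) * r ^ 2` with respect to the surface measure. -/
def sphInt (f : E3 → ℝ) (z : E3) (r : ℝ) : ℝ :=
  ∫ θ : Metric.sphere (0 : E3) 1, f (z + r • (θ : E3)) * r ^ 2 ∂sigma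

/-- Surface integral of a vector field over the sphere of radius `R` centred at the origin,
parametrized by `z = R * ω` with `ω` in the unit sphere, so that `ds(z) = R ^ 2 dω`. -/
def bdryInt (R : ℝ) (F : E3 → E3) : E3 :=
  ∫ ω : Metric.sphere (0 : E3) 1, R ^ 2 • F (R • (ω : E3)) ∂sigma

/-- Integrability over the sphere of radius `R` centred at the origin. -/
def BdryIntegrable (R : ℝ) (F : E3 → E3) : Prop :=
  Integrable (fun ω : Metric.sphere (0 : E3) 1 => R ^ 2 • F (R • (ω : E3))) sigma

/-- The unit normal to the sphere `|z| = R` directed into the ball. -/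
def innerNormal (R : ℝ) (z : E3) : E3 := (-(1 / R)) • z

/-- The divergence `∑ i, ∂ V_i / ∂ y_i` of a vector field. -/
def divergence (V : E3 → E3) (y : E3) : ℝ :=
  ∑ i : Fin 3, (fderiv ℝ V y (EuclideanSpace.single i 1)) i

/-- Bessel function of the first kind of real order `ν`, for positive argument. -/
def besselJ (ν t : ℝ) : ℝ :=
  ∑' k : ℕ, (-1 : ℝ) ^ k / ((k.factorial : ℝ) * Real.Gamma (k + ν + 1)) *
    (t / 2) ^ (2 * (k : ℝ) + ν)

/-- Neumann function (Bessel function of the second kind) of non-integer real order `ν`,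
for positive argument. -/
def besselN (ν t : ℝ) : ℝ :=
  (besselJ ν t * Real.cos (ν * Real.pi) - besselJ (-ν) t) / Real.sin (ν * Real.pi)

/-- Spherical Bessel function of order zero. -/
def j0 (t : ℝ) : ℝ := Real.sqrt (Real.pi / (2 * t)) * besselJ (1 / 2) t

/-- Spherical Neumann function of order zero. -/
def n0 (t : ℝ) : ℝ := Real.sqrt (Real.pi / (2 * t)) * besselN (1 / 2) t

/-- The integrand, as a function of the frequency `l`, of the filtration step applied to a
function `u` on `[0, 2R]`, with its constant `2 / π`. -/
def filterIntegrand (R : ℝ) (u : ℝ → ℝ) (t l : ℝ) : ℝ :=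
  2 / Real.pi * ((n0 (l * t) * (∫ s in (0 : ℝ)..(2 * R), j0 (l * s) * u s) -
    j0 (l * t) * (∫ s in (0 : ℝ)..(2 * R), n0 (l * s) * u s)) * l ^ 3)

/-- The Abel means of the filtration integral over `0 < l < ∞`. -/
def filterAbel (R : ℝ) (u : ℝ → ℝ) (t ε : ℝ) : ℝ :=
  ∫ l in Ioi (0 : ℝ), Real.exp (-(ε * l)) * filterIntegrand R u t l

/-- The filtration step: the integral of `filterIntegrand` over `0 < l < ∞`, evaluated as the
limit of its Abel means. -/
def filtration (R : ℝ) (u : ℝ → ℝ) (t : ℝ) : ℝ :=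
  limUnder (𝓝[>] (0 : ℝ)) (filterAbel R u t)

/-- The derivative `d/dt (u(t) / t)`. -/
def quotDeriv (u : ℝ → ℝ) (t : ℝ) : ℝ := deriv (fun s => u s / s) t

end SphMean

end

noncomputable section

namespace SphMean

open scoped ENNReal

/-! Filtration. Since `j0` is sin t / t and `n0` is -cos t / t, the integrand is 2l/(πt) times the
integral over s of sin(l(t-s)) v(s), where v(s) = g(z,s)/s. As v vanishes at 0 and at 2R, one
integration by parts absorbs the factor l and leaves -2/(πt) times the integral of cos(l(t-s))
v'(s). Damping by exp(-εl) and integrating in l turns the cosine into the Poisson kernel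
ε/(ε²+(t-s)²), an approximate identity of mass π, so the Abel limit is -(2/t) v'(t). Abel's theorem
identifies this with any convergent improper integral. If f is C², a second integration by parts
writes the cosine transform as a sine transform divided by l; the sine transform is square
integrable (`integrableOn_sq_sineTransform`), hence the integral converges absolutely.

Inversion. For y inside B, let M(p) be the integral over unit vectors ω of ω times the integral of f
over the ball centred at Rω with squared radius |y-Rω|²+p (`ballMoment`). Its symmetric second
difference quotient at p = 0 is computed in two ways. Differentiating the ball integrals in their
squared radius produces (1/(4t)) d/dt (g/t) at t = |y-Rω|, that is, the boundary integral of the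
theorem up to a constant (`tendsto_ballMoment_sphere`). Exchanging the integrals instead, the ω
whose ball contains y+w form a spherical cap whose height h is affine in p with slope -1/(2R|w|).
The vector area of the cap is π(1-h²)₊ w/|w| (`integral_cap`, from Archimedes' theorem), so the
second difference is -πp²/(2R²|w|²) times w/|w|, and the polar Jacobian cancels |w|²
(`tendsto_ballMoment_radialField`). What remains is -π/(2R²) times the field with integrand f(y+rθ)θ
dr dθ. The divergence of that field integrates the radial derivative of f along every ray from y,
which gives -4π f(y) (`divergence_radialField`). -/

/-! ### Spherical Bessel functions of order zero and the filtration integrand -/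

theorem besselJ_half {t : ℝ} (ht : 0 < t) :
    besselJ (1 / 2) t = Real.sin t / (√Real.pi * √(t / 2)) := by
  have h := (Real.hasSum_sin t).div_const (√Real.pi * √(t / 2))
  rw [← h.tsum_eq, besselJ]
  refine tsum_congr fun k => ?_
  -- Legendre duplication turns k! Γ(k+3/2) into a multiple of (2k+1)!, so the series matches the
  -- sine series term by term.
  have hG := Real.Gamma_mul_Gamma_add_half ((k : ℝ) + 1)
  rw [Real.Gamma_nat_eq_factorial, show 2 * ((k : ℝ) + 1) = ((2 * k + 1 : ℕ) : ℝ) + 1 by push_cast; ring,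
    Real.Gamma_nat_eq_factorial,
    show (1 : ℝ) - (((2 * k + 1 : ℕ) : ℝ) + 1) = -((2 * k + 1 : ℕ) : ℝ) by ring,
    Real.rpow_neg two_pos.le, Real.rpow_natCast] at hG
  have h2 : (t / 2) ^ (2 * (k : ℝ) + 1 / 2) * √(t / 2) = (t / 2) ^ (2 * k + 1) := by
    rw [Real.sqrt_eq_rpow, ← Real.rpow_add (by positivity), ← Real.rpow_natCast]
    congr 1; push_cast; ring
  rw [show (k : ℝ) + 1 / 2 + 1 = (k : ℝ) + 1 + 1 / 2 by ring, hG]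
  have h3 : (t / 2) ^ (2 * (k : ℝ) + 1 / 2) = (t / 2) ^ (2 * k + 1) / √(t / 2) := by
    rw [eq_div_iff (by positivity), h2]
  rw [h3, div_pow]
  field_simp

theorem besselJ_neg_half {t : ℝ} (ht : 0 < t) :
    besselJ (-(1 / 2)) t = Real.cos t / (√Real.pi * √(t / 2)) := by
  have h := (Real.hasSum_cos t).div_const (√Real.pi * √(t / 2))
  rw [← h.tsum_eq, besselJ]
  refine tsum_congr fun k => ?_
  have hG := Real.Gamma_mul_Gamma_add_half ((k : ℝ) + 1 / 2)
  rw [show (k : ℝ) + 1 / 2 + 1 / 2 = k + 1 by ring,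
    Real.Gamma_nat_eq_factorial, show 2 * ((k : ℝ) + 1 / 2) = ((2 * k : ℕ) : ℝ) + 1 by push_cast; ring,
    Real.Gamma_nat_eq_factorial,
    show (1 : ℝ) - (((2 * k : ℕ) : ℝ) + 1) = -((2 * k : ℕ) : ℝ) by ring,
    Real.rpow_neg two_pos.le, Real.rpow_natCast] at hG
  have h2 : (t / 2) ^ (2 * (k : ℝ) + -(1 / 2)) * √(t / 2) = (t / 2) ^ (2 * k) := by
    rw [Real.sqrt_eq_rpow, ← Real.rpow_add (by positivity), ← Real.rpow_natCast]
    congr 1; push_cast; ring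
  rw [show (k : ℝ) + -(1 / 2) + 1 = (k : ℝ) + 1 / 2 by ring, mul_comm (k.factorial : ℝ), hG]
  have h3 : (t / 2) ^ (2 * (k : ℝ) + -(1 / 2)) = (t / 2) ^ (2 * k) / √(t / 2) := by
    rw [eq_div_iff (by positivity), h2]
  rw [h3, div_pow]
  field_simp

theorem sqrt_pi_div_mul_div {t : ℝ} (ht : 0 < t) (c : ℝ) :
    √(Real.pi / (2 * t)) * (c / (√Real.pi * √(t / 2))) = c / t := by
  have h : √(Real.pi / (2 * t)) * t = √Real.pi * √(t / 2) := by
    rw [← Real.sqrt_mul Real.pi_pos.le]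
    nth_rw 2 [← Real.sqrt_sq ht.le]
    rw [← Real.sqrt_mul (by positivity)]
    congr 1; field_simp
  rw [← h]
  field_simp

theorem j0_eq {t : ℝ} (ht : 0 < t) : j0 t = Real.sin t / t := by
  rw [j0, besselJ_half ht, sqrt_pi_div_mul_div ht]

theorem n0_eq {t : ℝ} (ht : 0 < t) : n0 t = -Real.cos t / t := by
  rw [n0, besselN, besselJ_neg_half ht, show 1 / 2 * Real.pi = Real.pi / 2 by ring,
    Real.cos_pi_div_two, Real.sin_pi_div_two, mul_zero, zero_sub, div_one, ← neg_div,
    sqrt_pi_div_mul_div ht]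

/-- The filtration integrand in terms of trigonometric functions. -/
theorem filterIntegrand_eq_sin {R t l : ℝ} (hR : 0 < R) (ht : 0 < t) (hl : 0 ≤ l)
    {u v : ℝ → ℝ} (hv : Continuous v) (huv : ∀ s, 0 < s → u s = s * v s) :
    filterIntegrand R u t l =
      2 / (Real.pi * t) * (l * ∫ s in (0 : ℝ)..(2 * R), Real.sin (l * (t - s)) * v s) := by
  rcases hl.eq_or_lt with rfl | hl
  · simp [filterIntegrand]
  have h1 : ∫ s in (0 : ℝ)..(2 * R), j0 (l * s) * u s =
      (∫ s in (0 : ℝ)..(2 * R), Real.sin (l * s) * v s) / l := by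
    rw [← intervalIntegral.integral_div]
    -- The interval is half open, so s = 0, where `j0` and `n0` have only default values, never
    -- enters.
    refine intervalIntegral.integral_congr_ae (ae_of_all _ fun s hs => ?_)
    rw [uIoc_of_le (by positivity)] at hs
    have := hs.1
    rw [j0_eq (by positivity), huv s this]
    field_simp
  have h2 : ∫ s in (0 : ℝ)..(2 * R), n0 (l * s) * u s =
      -(∫ s in (0 : ℝ)..(2 * R), Real.cos (l * s) * v s) / l := by
    rw [← intervalIntegral.integral_neg, ← intervalIntegral.integral_div]
    refine intervalIntegral.integral_congr_ae (ae_of_all _ fun s hs => ?_)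
    rw [uIoc_of_le (by positivity)] at hs
    have := hs.1
    rw [n0_eq (by positivity), huv s this]
    field_simp
  have h3 : ∫ s in (0 : ℝ)..(2 * R), Real.sin (l * (t - s)) * v s =
      Real.sin (l * t) * (∫ s in (0 : ℝ)..(2 * R), Real.cos (l * s) * v s) -
        Real.cos (l * t) * ∫ s in (0 : ℝ)..(2 * R), Real.sin (l * s) * v s := by
    rw [← intervalIntegral.integral_const_mul, ← intervalIntegral.integral_const_mul,
      ← intervalIntegral.integral_sub]
    · refine intervalIntegral.integral_congr fun s _ => ?_
      simp only [mul_sub, Real.sin_sub]; ring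
    · exact Continuous.intervalIntegrable (by fun_prop) _ _
    · exact Continuous.intervalIntegrable (by fun_prop) _ _
  rw [filterIntegrand, h1, h2, h3, j0_eq (by positivity), n0_eq (by positivity)]
  field_simp
  ring

/-- The filtration integrand after one integration by parts. -/
theorem filterIntegrand_eq_cos {R t l : ℝ} (hR : 0 < R) (ht : 0 < t) (hl : 0 ≤ l)
    {u v k : ℝ → ℝ} (hk : Continuous k) (hv : ∀ s, HasDerivAt v (k s) s)
    (huv : ∀ s, 0 < s → u s = s * v s) (h0 : v 0 = 0) (h1 : v (2 * R) = 0) :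
    filterIntegrand R u t l =
      -(2 / (Real.pi * t)) * ∫ s in (0 : ℝ)..(2 * R), Real.cos (l * (t - s)) * k s := by
  have hvc : Continuous v := continuous_iff_continuousAt.2 fun s => (hv s).continuousAt
  rw [filterIntegrand_eq_sin hR ht hl hvc huv, neg_mul, ← mul_neg]
  congr 1
  have := intervalIntegral.integral_mul_deriv_eq_deriv_mul (a := 0) (b := 2 * R)
    (u := fun s => Real.cos (l * (t - s))) (u' := fun s => l * Real.sin (l * (t - s)))
    (v := v) (v' := k) ?_ (fun s _ => hv s)
    (Continuous.intervalIntegrable (by fun_prop) _ _)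
    (Continuous.intervalIntegrable (by fun_prop) _ _)
  · rw [this, h0, h1, ← intervalIntegral.integral_const_mul]
    simp [mul_assoc]
  · intro s _
    have := (((hasDerivAt_id s).const_sub t).const_mul l).cos
    simpa [mul_comm] using this

/-! ### Damped frequency integrals and the Poisson kernel -/

theorem integrableOn_exp_mul_bdd {ε : ℝ} (hε : 0 < ε) {w : ℝ → ℝ} (hw : Continuous w) {C : ℝ}
    (hC : ∀ l, 0 < l → |w l| ≤ C) :
    IntegrableOn (fun l => Real.exp (-(ε * l)) * w l) (Ioi 0) := by
  have h := (exp_neg_integrableOn_Ioi 0 hε).mul_const C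
  refine h.mono' (Continuous.aestronglyMeasurable (by fun_prop)) ?_
  refine (ae_restrict_mem measurableSet_Ioi).mono fun l hl => ?_
  rw [Real.norm_eq_abs, abs_mul, Real.abs_exp, neg_mul]
  gcongr
  exact hC l hl

/-- The Laplace transform of a cosine. -/
theorem integral_exp_mul_cos {ε : ℝ} (hε : 0 < ε) (a : ℝ) :
    ∫ l in Ioi (0 : ℝ), Real.exp (-(ε * l)) * Real.cos (l * a) = ε / (ε ^ 2 + a ^ 2) := by
  have hne : ε ^ 2 + a ^ 2 ≠ 0 := by positivity
  have hd : ∀ l ∈ Ici (0 : ℝ), HasDerivAt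
      (fun l => Real.exp (-(ε * l)) * ((a * Real.sin (l * a) - ε * Real.cos (l * a)) /
        (ε ^ 2 + a ^ 2))) (Real.exp (-(ε * l)) * Real.cos (l * a)) l := by
    intro l _
    have h1 := (((hasDerivAt_id l).const_mul ε).neg).exp
    have h2 := (((hasDerivAt_id l).mul_const a).sin.const_mul a)
    have h3 := (((hasDerivAt_id l).mul_const a).cos.const_mul ε)
    refine (h1.mul ((h2.sub h3).div_const (ε ^ 2 + a ^ 2))).congr_deriv ?_
    simp only [id_eq, mul_one, one_mul, mul_neg, neg_mul, Pi.neg_apply, Pi.sub_apply]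
    field_simp
    ring
  have ht : Tendsto (fun l => Real.exp (-(ε * l)) *
      ((a * Real.sin (l * a) - ε * Real.cos (l * a)) / (ε ^ 2 + a ^ 2))) atTop (𝓝 0) := by
    refine Tendsto.zero_mul_isBoundedUnder_le
      (Real.tendsto_exp_neg_atTop_nhds_zero.comp (tendsto_id.const_mul_atTop hε)) ?_
    refine isBoundedUnder_of ⟨(|a| + |ε|) / (ε ^ 2 + a ^ 2), fun l => ?_⟩
    simp only [Function.comp, Real.norm_eq_abs, abs_div]
    rw [abs_of_pos (show 0 < ε ^ 2 + a ^ 2 by positivity)]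
    gcongr
    refine (abs_sub _ _).trans ?_
    rw [abs_mul, abs_mul]
    gcongr
    · exact mul_le_of_le_one_right (abs_nonneg _) (Real.abs_sin_le_one _)
    · exact mul_le_of_le_one_right (abs_nonneg _) (Real.abs_cos_le_one _)
  rw [integral_Ioi_of_hasDerivAt_of_tendsto' hd
    (integrableOn_exp_mul_bdd hε (C := 1) (by fun_prop) fun l _ => Real.abs_cos_le_one _) ht]
  simp
  field_simp

/-- Exchange of a damped frequency integral with an integral over a bounded interval. -/
theorem integral_exp_mul_intervalIntegral_swap {ε b W : ℝ} (hε : 0 < ε) (hb : 0 ≤ b)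
    {w k : ℝ → ℝ} (hw : Continuous w) (hW : ∀ l, 0 < l → |w l| ≤ W) (hk : Continuous k)
    {q : ℝ → ℝ → ℝ} (hq : Continuous (Function.uncurry q)) (hq1 : ∀ l s, |q l s| ≤ 1) :
    ∫ l in Ioi (0 : ℝ), Real.exp (-(ε * l)) * (w l * ∫ s in (0 : ℝ)..b, q l s * k s) =
      ∫ s in (0 : ℝ)..b, (∫ l in Ioi (0 : ℝ), Real.exp (-(ε * l)) * (w l * q l s)) * k s := by
  have h1 : ∀ l, Real.exp (-(ε * l)) * (w l * ∫ s in (0 : ℝ)..b, q l s * k s) =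
      ∫ s in Ioc 0 b, q l s * (Real.exp (-(ε * l)) * w l * k s) := by
    intro l
    rw [intervalIntegral.integral_of_le hb, ← mul_assoc, ← integral_const_mul]
    exact integral_congr_ae (ae_of_all _ fun s => by ring)
  have h2 : ∀ s, (∫ l in Ioi (0 : ℝ), Real.exp (-(ε * l)) * (w l * q l s)) * k s =
      ∫ l in Ioi (0 : ℝ), q l s * (Real.exp (-(ε * l)) * w l * k s) := by
    intro s
    rw [← integral_mul_const]
    exact integral_congr_ae (ae_of_all _ fun s => by ring)
  simp_rw [h1, h2]
  rw [intervalIntegral.integral_of_le hb]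
  refine integral_integral_swap ?_
  have h3 := Integrable.mul_prod (integrableOn_exp_mul_bdd hε hw hW)
    ((hk.integrableOn_Icc (μ := volume) (a := 0) (b := b)).mono_set Ioc_subset_Icc_self)
  refine h3.bdd_mul (c := 1) (f := Function.uncurry q) hq.aestronglyMeasurable
    (ae_of_all _ fun z => hq1 _ _)

theorem integrable_poisson {ε : ℝ} (hε : 0 < ε) (a : ℝ) :
    Integrable (fun s : ℝ => ε / (ε ^ 2 + (a - s) ^ 2)) := by
  have h := (integrable_inv_one_add_sq.comp_mul_left' (inv_ne_zero hε.ne')).comp_sub_left a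
  refine (h.const_mul ε⁻¹).congr (ae_of_all _ fun s => ?_)
  have h1 : 1 + (ε⁻¹ * (a - s)) ^ 2 ≠ 0 := by positivity
  have h2 : ε ^ 2 + (a - s) ^ 2 ≠ 0 := by positivity
  simp only
  field_simp

theorem integral_poisson_mul {ε : ℝ} (hε : 0 < ε) (a : ℝ) (φ : ℝ → ℝ) :
    ∫ s : ℝ, ε / (ε ^ 2 + (a - s) ^ 2) * φ s = ∫ x : ℝ, (1 + x ^ 2)⁻¹ * φ (a - ε * x) := by
  rw [← integral_sub_left_eq_self _ volume a]
  have h := Measure.integral_comp_mul_left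
    (fun x : ℝ => ε / (ε ^ 2 + (a - (a - x)) ^ 2) * φ (a - x)) ε
  rw [abs_of_pos (inv_pos.2 hε), smul_eq_mul, eq_comm, inv_mul_eq_iff_eq_mul₀ hε.ne',
    ← integral_const_mul] at h
  rw [h]
  refine integral_congr_ae (ae_of_all _ fun x => ?_)
  have h1 : 1 + x ^ 2 ≠ 0 := by positivity
  simp only [sub_sub_cancel]
  rw [show ε ^ 2 + (ε * x) ^ 2 = ε ^ 2 * (1 + x ^ 2) by ring]
  field_simp

theorem integral_poisson {ε : ℝ} (hε : 0 < ε) (a : ℝ) :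
    ∫ s : ℝ, ε / (ε ^ 2 + (a - s) ^ 2) = Real.pi := by
  have := integral_poisson_mul hε a (fun _ => 1)
  simpa using this

theorem intervalIntegral_poisson_le {ε b : ℝ} (hε : 0 < ε) (hb : 0 ≤ b) (a : ℝ) :
    ∫ s in (0 : ℝ)..b, ε / (ε ^ 2 + (a - s) ^ 2) ≤ Real.pi := by
  rw [intervalIntegral.integral_of_le hb, ← integral_poisson hε a]
  exact setIntegral_le_integral (integrable_poisson hε a) (ae_of_all _ fun s => by positivity)

/-- The Poisson kernel is an approximate identity. -/
theorem tendsto_intervalIntegral_poisson {b t : ℝ} (hb : 0 < b) (ht : 0 < t) {k : ℝ → ℝ}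
    (hk : Continuous k) (h0 : k 0 = 0) (h1 : ∀ s, b ≤ s → k s = 0) :
    Tendsto (fun ε => ∫ s in (0 : ℝ)..b, ε / (ε ^ 2 + (t - s) ^ 2) * k s) (𝓝[>] 0)
      (𝓝 (Real.pi * k t)) := by
  -- Because k vanishes at 0 and from b on, freezing it to the left of 0 gives its continuous
  -- bounded extension by zero. The integral then runs over the whole line and can be rescaled by ε.
  set φ : ℝ → ℝ := fun s => k (max s 0) with hφ
  have hφc : Continuous φ := by fun_prop
  obtain ⟨C, hC⟩ := (isCompact_Icc (a := (0 : ℝ)) (b := b)).exists_bound_of_continuousOn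
    hk.continuousOn
  have hφC : ∀ s, ‖φ s‖ ≤ C := by
    intro s
    rcases le_total b s with h | h
    · have := hC 0 ⟨le_rfl, hb.le⟩
      rw [h0] at this
      simpa [hφ, max_eq_left (hb.le.trans h), h1 s h] using this
    · exact hC _ ⟨le_max_right _ _, max_le h hb.le⟩
  have hlim : Tendsto (fun ε => ∫ x : ℝ, (1 + x ^ 2)⁻¹ * φ (t - ε * x)) (𝓝[>] 0)
      (𝓝 (∫ x : ℝ, (1 + x ^ 2)⁻¹ * φ t)) := by
    refine tendsto_integral_filter_of_dominated_convergence (fun x => (1 + x ^ 2)⁻¹ * C) ?_ ?_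
      (integrable_inv_one_add_sq.mul_const C) ?_
    · refine Eventually.of_forall fun ε => Continuous.aestronglyMeasurable ?_
      refine Continuous.mul (Continuous.inv₀ (by fun_prop) fun x => by positivity) (by fun_prop)
    · refine Eventually.of_forall fun ε => ae_of_all _ fun x => ?_
      rw [norm_mul, Real.norm_of_nonneg (by positivity)]
      gcongr
      exact hφC _
    · refine ae_of_all _ fun x => ?_
      have : Continuous fun ε : ℝ => (1 + x ^ 2)⁻¹ * φ (t - ε * x) := by fun_prop
      have := (this.tendsto 0).mono_left (nhdsWithin_le_nhds (s := Ioi 0))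
      simpa using this
  rw [integral_mul_const, integral_univ_inv_one_add_sq] at hlim
  have hφt : φ t = k t := by simp [hφ, max_eq_left ht.le]
  rw [hφt] at hlim
  refine hlim.congr' ?_
  filter_upwards [self_mem_nhdsWithin] with ε hε
  rw [← integral_poisson_mul hε, intervalIntegral.integral_of_le hb.le,
    ← setIntegral_eq_integral_of_forall_compl_eq_zero (s := Ioc 0 b)]
  · refine setIntegral_congr_fun measurableSet_Ioc fun s hs => ?_
    simp [hφ, max_eq_left hs.1.le]
  · intro s hs
    rcases le_or_gt s 0 with h | h
    · simp [hφ, max_eq_right h, h0]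
    · have : b ≤ s := by
        by_contra hlt
        exact hs ⟨h, (not_le.1 hlt).le⟩
      simp [hφ, max_eq_left h.le, h1 s this]

/-! ### Abel summation and square integrability of sine transforms -/

/-- Abel's theorem for improper integrals. -/
theorem tendsto_laplace_of_tendsto {F : ℝ → ℝ} (hF : Continuous F) {C L : ℝ}
    (hC : ∀ l, |F l| ≤ C) (hL : Tendsto (fun x => ∫ l in (0 : ℝ)..x, F l) atTop (𝓝 L)) :
    Tendsto (fun ε => ∫ l in Ioi (0 : ℝ), Real.exp (-(ε * l)) * F l) (𝓝[>] 0) (𝓝 L) := by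
  set Φ : ℝ → ℝ := fun x => ∫ l in (0 : ℝ)..x, F l with hΦ
  have hd : ∀ x, HasDerivAt Φ (F x) x := fun x => hF.integral_hasStrictDerivAt 0 x |>.hasDerivAt
  have hΦc : Continuous Φ := continuous_iff_continuousAt.2 fun x => (hd x).continuousAt
  obtain ⟨D, hD⟩ : ∃ D, ∀ x, 0 < x → |Φ x| ≤ D := by
    obtain ⟨N, hN⟩ := eventually_atTop.1 (hL.abs.eventually (gt_mem_nhds (lt_add_one |L|)))
    obtain ⟨D, hD⟩ := (isCompact_Icc (a := (0 : ℝ)) (b := N)).exists_bound_of_continuousOn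
      hΦc.continuousOn
    refine ⟨max D (|L| + 1), fun x hx => ?_⟩
    rcases le_total N x with h | h
    · exact (hN x h).le.trans (le_max_right _ _)
    · exact (hD x ⟨hx.le, h⟩).trans (le_max_left _ _)
  -- Integration by parts gives ε times the Laplace integral of the primitive Φ; the substitution x
  -- = εl moves ε inside Φ, where dominated convergence applies.
  have key : ∀ ε, 0 < ε → ∫ l in Ioi (0 : ℝ), Real.exp (-(ε * l)) * F l =
      ∫ x in Ioi (0 : ℝ), Real.exp (-x) * Φ (ε⁻¹ * x) := by
    intro ε hε
    have hI := integrableOn_exp_mul_bdd hε hΦc hD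
    have h := integral_Ioi_mul_deriv_eq_deriv_mul (a := 0) (a' := 0) (b' := 0)
      (u := fun l => Real.exp (-(ε * l))) (u' := fun l => -ε * Real.exp (-(ε * l)))
      (v := Φ) (v' := F) ?_ (fun x _ => hd x)
      (integrableOn_exp_mul_bdd hε hF fun l _ => hC l) ?_ ?_ ?_
    · rw [h]
      have h2 := integral_comp_mul_left_Ioi (fun x => Real.exp (-x) * Φ (ε⁻¹ * x)) 0 hε
      rw [mul_zero, smul_eq_mul, eq_comm, inv_mul_eq_iff_eq_mul₀ hε.ne'] at h2
      rw [h2, sub_zero, zero_sub, ← integral_neg, ← integral_const_mul]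
      refine integral_congr_ae (ae_of_all _ fun x => ?_)
      simp only [inv_mul_cancel_left₀ hε.ne']
      ring
    · intro l _
      have h1 := (((hasDerivAt_id l).const_mul ε).neg).exp
      simpa [mul_comm] using h1
    · refine (hI.const_mul (-ε)).congr (ae_of_all _ fun x => ?_)
      simp [mul_assoc]
    · have : Continuous ((fun l => Real.exp (-(ε * l))) * Φ) := by
        apply Continuous.mul (by fun_prop) hΦc
      have := (this.tendsto 0).mono_left (nhdsWithin_le_nhds (s := Ioi 0))
      simpa [hΦ] using this
    · have h1 : Tendsto (fun l : ℝ => Real.exp (-(ε * l))) atTop (𝓝 0) :=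
        Real.tendsto_exp_neg_atTop_nhds_zero.comp (tendsto_id.const_mul_atTop hε)
      simpa [Pi.mul_def] using h1.mul hL
  have hlim : Tendsto (fun ε => ∫ x in Ioi (0 : ℝ), Real.exp (-x) * Φ (ε⁻¹ * x)) (𝓝[>] 0)
      (𝓝 (∫ x in Ioi (0 : ℝ), Real.exp (-x) * L)) := by
    refine tendsto_integral_filter_of_dominated_convergence (fun x => Real.exp (-x) * D) ?_ ?_ ?_ ?_
    · exact Eventually.of_forall fun ε => Continuous.aestronglyMeasurable (by fun_prop)
    · filter_upwards [self_mem_nhdsWithin] with ε hε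
      refine (ae_restrict_mem measurableSet_Ioi).mono fun x hx => ?_
      rw [norm_mul, Real.norm_eq_abs, Real.abs_exp]
      gcongr
      exact hD _ (mul_pos (inv_pos.2 hε) hx)
    · simpa using (exp_neg_integrableOn_Ioi 0 one_pos).mul_const D
    · refine (ae_restrict_mem measurableSet_Ioi).mono fun x hx => ?_
      exact (hL.comp (tendsto_inv_nhdsGT_zero.atTop_mul_const hx)).const_mul _
  rw [integral_mul_const, integral_exp_neg_Ioi_zero, one_mul] at hlim
  refine hlim.congr' ?_
  filter_upwards [self_mem_nhdsWithin] with ε hε using (key ε hε).symm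

/-- The sine transform of a continuous function on a bounded interval is square integrable. -/
theorem integrableOn_sq_sineTransform {b : ℝ} (hb : 0 ≤ b) (t : ℝ) {H : ℝ → ℝ}
    (hH : Continuous H) :
    IntegrableOn (fun l => (∫ s in (0 : ℝ)..b, Real.sin (l * (t - s)) * H s) ^ 2) (Ioi 0) := by
  set S : ℝ → ℝ := fun l => ∫ s in (0 : ℝ)..b, Real.sin (l * (t - s)) * H s with hS
  have hSc : Continuous S :=
    intervalIntegral.continuous_parametric_intervalIntegral_of_continuous' (by fun_prop) 0 b
  obtain ⟨C, hC⟩ := (isCompact_Icc (a := (0 : ℝ)) (b := b)).exists_bound_of_continuousOn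
    hH.continuousOn
  have hC0 : 0 ≤ C := (norm_nonneg _).trans (hC 0 ⟨le_rfl, hb⟩)
  have hSb : ∀ l, |S l| ≤ C * b := by
    intro l
    have := intervalIntegral.norm_integral_le_of_norm_le_const (a := 0) (b := b) (C := C)
      (f := fun s => Real.sin (l * (t - s)) * H s) ?_
    · simpa [abs_of_nonneg hb] using this
    · intro s hs
      rw [uIoc_of_le hb] at hs
      rw [norm_mul]
      exact (mul_le_of_le_one_left (norm_nonneg _) (Real.abs_sin_le_one _)).trans
        (hC s (Ioc_subset_Icc_self hs))
  -- A substitute for Plancherel: sin·sin is half a difference of cosines, so the damped correlation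
  -- kernel is half a difference of two Poisson kernels, each of mass at most π whatever ε is.
  have hinner : ∀ ε, 0 < ε → ∀ s,
      |∫ l in Ioi (0 : ℝ), Real.exp (-(ε * l)) * (S l * Real.sin (l * (t - s)))| ≤
        C * Real.pi := by
    intro ε hε s
    have hk : ∀ s', ∫ l in Ioi (0 : ℝ), Real.exp (-(ε * l)) *
        (Real.sin (l * (t - s)) * Real.sin (l * (t - s'))) =
        (ε / (ε ^ 2 + (s - s') ^ 2) - ε / (ε ^ 2 + ((2 * t - s) - s') ^ 2)) / 2 := by
      intro s'
      have hi : ∀ a, IntegrableOn (fun l => Real.exp (-(ε * l)) * Real.cos (l * a)) (Ioi 0) :=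
        fun a => integrableOn_exp_mul_bdd hε (by fun_prop) fun l _ => Real.abs_cos_le_one _
      rw [← integral_exp_mul_cos hε, ← integral_exp_mul_cos hε, ← integral_sub (hi _) (hi _),
        ← integral_div]
      refine integral_congr_ae (ae_of_all _ fun l => ?_)
      simp only
      rw [show l * (s - s') = l * (t - s') - l * (t - s) by ring,
        show l * (2 * t - s - s') = l * (t - s') + l * (t - s) by ring, Real.cos_add,
        Real.cos_sub]
      ring
    have hsw := integral_exp_mul_intervalIntegral_swap (W := 1) hε hb
      (w := fun l => Real.sin (l * (t - s))) (by fun_prop) (fun l _ => Real.abs_sin_le_one _) hH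
      (q := fun l s' => Real.sin (l * (t - s'))) (by fun_prop) (fun _ _ => Real.abs_sin_le_one _)
    simp_rw [mul_comm (S _), hS]
    rw [hsw]
    simp_rw [hk]
    have hc1 : ∀ a, IntervalIntegrable (fun s' : ℝ => ε / (ε ^ 2 + (a - s') ^ 2)) volume 0 b :=
      fun a => (integrable_poisson hε a).intervalIntegrable
    rw [← Real.norm_eq_abs]
    refine (intervalIntegral.norm_integral_le_of_norm_le hb
      (g := fun s' => (ε / (ε ^ 2 + (s - s') ^ 2) + ε / (ε ^ 2 + ((2 * t - s) - s') ^ 2)) / 2 * C)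
      (ae_of_all _ fun s' hs' => ?_) (((hc1 _).add (hc1 _)).div_const 2 |>.mul_const C)).trans ?_
    · rw [norm_mul, norm_div, Real.norm_of_nonneg (zero_le_two (α := ℝ))]
      gcongr
      · refine (norm_sub_le _ _).trans ?_
        rw [Real.norm_of_nonneg (by positivity), Real.norm_of_nonneg (by positivity)]
      · exact hC s' (Ioc_subset_Icc_self hs')
    · rw [intervalIntegral.integral_mul_const, intervalIntegral.integral_div,
        intervalIntegral.integral_add (hc1 _) (hc1 _), mul_comm]
      have e1 := intervalIntegral_poisson_le hε hb s
      have e2 := intervalIntegral_poisson_le hε hb (2 * t - s)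
      gcongr
      linarith
  have hA : ∀ ε, 0 < ε → ∫ l in Ioi (0 : ℝ), Real.exp (-(ε * l)) * S l ^ 2 ≤
      C * Real.pi * C * b := by
    intro ε hε
    have hsw := integral_exp_mul_intervalIntegral_swap hε hb hSc (fun l _ => hSb l) hH
      (q := fun l s => Real.sin (l * (t - s))) (by fun_prop) (fun _ _ => Real.abs_sin_le_one _)
    have : ∀ l, S l ^ 2 = S l * ∫ s in (0 : ℝ)..b, Real.sin (l * (t - s)) * H s :=
      fun l => sq (S l)
    simp_rw [this, hsw]
    refine (le_abs_self _).trans ?_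
    have := intervalIntegral.norm_integral_le_of_norm_le_const (a := 0) (b := b)
      (C := C * Real.pi * C) (f := fun s => (∫ l in Ioi (0 : ℝ), Real.exp (-(ε * l)) *
        (S l * Real.sin (l * (t - s)))) * H s) ?_
    · simpa [abs_of_nonneg hb] using this
    · intro s hs
      rw [uIoc_of_le hb] at hs
      rw [norm_mul]
      gcongr
      · exact hinner ε hε s
      · exact hC s (Ioc_subset_Icc_self hs)
  refine integrableOn_Ioi_of_intervalIntegral_norm_bounded (l := atTop) (b := id)
    (Real.exp 1 * (C * Real.pi * C * b)) 0 (fun i => ?_) tendsto_id ?_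
  · exact ((hSc.pow 2).integrableOn_Icc).mono_set Ioc_subset_Icc_self
  · filter_upwards [eventually_gt_atTop 0] with N hN
    -- With ε = 1/N the damping factor is at least exp(-1) on (0, N], so the bound uniform in ε
    -- controls the undamped integral over (0, N].
    have hN' : 0 < N⁻¹ := inv_pos.2 hN
    have hi : IntegrableOn (fun l => Real.exp (-(N⁻¹ * l)) * S l ^ 2) (Ioi 0) :=
      integrableOn_exp_mul_bdd hN' (hSc.pow 2) (C := (C * b) ^ 2) fun l _ => by
        rw [abs_pow]; gcongr; exact hSb l
    refine le_trans ?_ (mul_le_mul_of_nonneg_left (hA _ hN') (Real.exp_pos 1).le)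
    rw [id, intervalIntegral.integral_of_le hN.le]
    refine le_trans ?_ (mul_le_mul_of_nonneg_left (setIntegral_mono_set hi
      (ae_of_all _ fun l => by positivity) (show Ioc 0 N ⊆ Ioi 0 from Ioc_subset_Ioi_self).eventuallyLE)
      (Real.exp_pos 1).le)
    rw [← integral_const_mul]
    refine setIntegral_mono_on ?_ ((hi.mono_set Ioc_subset_Ioi_self).const_mul _)
      measurableSet_Ioc fun l hl => ?_
    · exact ((hSc.pow 2).norm.integrableOn_Icc).mono_set Ioc_subset_Icc_self
    · rw [Real.norm_of_nonneg (sq_nonneg _), ← mul_assoc, ← Real.exp_add]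
      refine le_mul_of_one_le_left (sq_nonneg _) (Real.one_le_exp ?_)
      have : N⁻¹ * l ≤ 1 := by
        rw [inv_mul_le_iff₀ hN, mul_one]; exact hl.2
      linarith

/-! ### Regularity and support of spherical means -/

/-- Continuity adds the boundary sphere to the zero set. This makes the spherical means centred at a
boundary point vanish at radius 0 and at radius 2R. -/
theorem eq_zero_of_le_norm {R : ℝ} (hR : 0 < R) {f : E3 → ℝ} (hf : Continuous f)
    (hsupp : Function.support f ⊆ Metric.closedBall (0 : E3) R) {x : E3} (hx : R ≤ ‖x‖) :
    f x = 0 := by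
  have h1 : EqOn f (fun _ => 0) (Metric.closedBall (0 : E3) R)ᶜ := fun y hy => by
    by_contra h
    exact hy (hsupp h)
  refine h1.closure hf continuous_const ?_
  rw [closure_compl, interior_closedBall _ hR.ne']
  simpa using hx

/-- The spherical mean of `f`, without the normalization by the area of the sphere. -/
def sMean (f : E3 → ℝ) (z : E3) (t : ℝ) : ℝ :=
  ∫ θ : Metric.sphere (0 : E3) 1, f (z + t • (θ : E3)) ∂sigma

/-- The spherical mean of the radial derivative of `f`. -/
def sMeanD (f : E3 → ℝ) (z : E3) (t : ℝ) : ℝ :=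
  ∫ θ : Metric.sphere (0 : E3) 1, fderiv ℝ f (z + t • (θ : E3)) (θ : E3) ∂sigma

instance : IsFiniteMeasure sigma := inferInstanceAs (IsFiniteMeasure (Measure.toSphere _))

theorem norm_coe_sphere (θ : Metric.sphere (0 : E3) 1) : ‖(θ : E3)‖ = 1 :=
  mem_sphere_zero_iff_norm.1 θ.2

theorem sphInt_eq (f : E3 → ℝ) (z : E3) (t : ℝ) : sphInt f z t = t * (t * sMean f z t) := by
  rw [sphInt, integral_mul_const, sMean]
  ring

theorem integrable_sphere {F : Type*} [NormedAddCommGroup F]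
    {a : Metric.sphere (0 : E3) 1 → F} (ha : Continuous a) : Integrable a sigma :=
  ha.integrable_of_hasCompactSupport (HasCompactSupport.of_compactSpace a)

theorem hasDerivAt_sphere_integral {a a' : ℝ → Metric.sphere (0 : E3) 1 → ℝ} {C : ℝ}
    (ha : ∀ t, Continuous (a t)) (ha' : ∀ t, Continuous (a' t)) (hC : ∀ t θ, |a' t θ| ≤ C)
    (hd : ∀ t θ, HasDerivAt (fun t => a t θ) (a' t θ) t) (t : ℝ) :
    HasDerivAt (fun t => ∫ θ, a t θ ∂sigma) (∫ θ, a' t θ ∂sigma) t :=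
  (hasDerivAt_integral_of_dominated_loc_of_deriv_le (bound := fun _ => C) univ_mem
    (Eventually.of_forall fun t => (ha t).aestronglyMeasurable) (integrable_sphere (ha t))
    (ha' t).aestronglyMeasurable (ae_of_all _ fun θ t _ => hC t θ) (integrable_const C)
    (ae_of_all _ fun θ t _ => hd t θ)).2

theorem continuous_sphere_integral {X F : Type*} [TopologicalSpace X] [FirstCountableTopology X]
    [LocallyCompactSpace X] [NormedAddCommGroup F] [NormedSpace ℝ F]
    {a : X → Metric.sphere (0 : E3) 1 → F} (ha : Continuous (Function.uncurry a)) :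
    Continuous fun x => ∫ θ, a x θ ∂sigma := by
  have := continuous_parametric_integral_of_continuous (μ := sigma) ha isCompact_univ
  simpa using this

theorem exists_bound_of_hasCompactSupport {F : Type*} [NormedAddCommGroup F] {f : E3 → F}
    (hf : Continuous f) (hc : HasCompactSupport f) : ∃ C, 0 ≤ C ∧ ∀ x, ‖f x‖ ≤ C := by
  obtain ⟨C, hC⟩ := hf.bounded_above_of_compact_support hc
  exact ⟨C, (norm_nonneg _).trans (hC 0), hC⟩

section Regularity

variable {f : E3 → ℝ} (hf : ContDiff ℝ 1 f) (hc : HasCompactSupport f)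
include hf

theorem continuous_sMean : Continuous fun p : E3 × ℝ => sMean f p.1 p.2 := by
  have := hf.continuous
  exact continuous_sphere_integral (by fun_prop)

theorem continuous_sMeanD : Continuous fun p : E3 × ℝ => sMeanD f p.1 p.2 := by
  have := hf.continuous_fderiv one_ne_zero
  exact continuous_sphere_integral (by fun_prop)

theorem hasDerivAt_comp_ray (z θ : E3) (t : ℝ) :
    HasDerivAt (fun t : ℝ => f (z + t • θ)) (fderiv ℝ f (z + t • θ) θ) t := by
  have h1 : HasDerivAt (fun t : ℝ => z + t • θ) θ t := by
    simpa using ((hasDerivAt_id t).smul_const θ).const_add z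
  exact ((hf.differentiable one_ne_zero _).hasFDerivAt).comp_hasDerivAt t h1

include hc

theorem exists_bound_fderiv_ray : ∃ C, 0 ≤ C ∧ ∀ (x : E3) (θ : Metric.sphere (0 : E3) 1),
    |fderiv ℝ f x (θ : E3)| ≤ C := by
  obtain ⟨C, hC0, hC⟩ := exists_bound_of_hasCompactSupport
    (hf.continuous_fderiv one_ne_zero) (hc.fderiv ℝ)
  refine ⟨C, hC0, fun x θ => ?_⟩
  have := (fderiv ℝ f x).le_opNorm (θ : E3)
  rw [norm_coe_sphere, mul_one] at this
  exact this.trans (hC x)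

theorem hasDerivAt_sMean (z : E3) (t : ℝ) : HasDerivAt (sMean f z) (sMeanD f z t) t := by
  obtain ⟨C, -, hC⟩ := exists_bound_fderiv_ray hf hc
  have h1 := hf.continuous
  have h2 := hf.continuous_fderiv one_ne_zero
  exact hasDerivAt_sphere_integral (C := C) (a := fun t θ => f (z + t • (θ : E3)))
    (a' := fun t θ => fderiv ℝ f (z + t • (θ : E3)) (θ : E3)) (fun t => by fun_prop)
    (fun t => by fun_prop) (fun t θ => hC _ _) (fun t θ => hasDerivAt_comp_ray hf z θ t) t

theorem hasDerivAt_mul_sMean (z : E3) (t : ℝ) :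
    HasDerivAt (fun s => s * sMean f z s) (sMean f z t + t * sMeanD f z t) t := by
  exact ((hasDerivAt_id t).mul (hasDerivAt_sMean hf hc z t)).congr_deriv (by simp)

theorem hasDerivAt_sphInt_div (z : E3) {t : ℝ} (ht : 0 < t) :
    HasDerivAt (fun s => sphInt f z s / s) (sMean f z t + t * sMeanD f z t) t := by
  refine (hasDerivAt_mul_sMean hf hc z t).congr_of_eventuallyEq ?_
  filter_upwards [lt_mem_nhds ht] with s hs
  rw [sphInt_eq, mul_div_cancel_left₀ _ hs.ne']

theorem quotDeriv_eq (z : E3) {t : ℝ} (ht : 0 < t) :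
    quotDeriv (sphInt f z) t = sMean f z t + t * sMeanD f z t :=
  (hasDerivAt_sphInt_div hf hc z ht).deriv

theorem exists_bound_sMean : ∃ C, 0 ≤ C ∧ ∀ z t, |sMean f z t| ≤ C := by
  obtain ⟨C, h0, hC⟩ := exists_bound_of_hasCompactSupport hf.continuous hc
  exact ⟨C * sigma.real univ, by positivity, fun z t =>
    norm_integral_le_of_norm_le_const (ae_of_all _ fun θ => hC _)⟩

theorem exists_bound_sMeanD : ∃ C, 0 ≤ C ∧ ∀ z t, |sMeanD f z t| ≤ C := by
  obtain ⟨C, h0, hC⟩ := exists_bound_fderiv_ray hf hc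
  exact ⟨C * sigma.real univ, by positivity, fun z t => by
    rw [← Real.norm_eq_abs]
    exact norm_integral_le_of_norm_le_const (ae_of_all _ fun θ => hC _ θ)⟩

end Regularity

theorem exists_hasDerivAt_sMeanD {f : E3 → ℝ} (hf : ContDiff ℝ 2 f) (hc : HasCompactSupport f)
    (z : E3) : ∃ m : ℝ → ℝ, Continuous m ∧ ∀ t, HasDerivAt (sMeanD f z) (m t) t := by
  have hf1 : ContDiff ℝ 1 (fderiv ℝ f) := hf.fderiv_right (by norm_num)
  have h1 := hf1.continuous
  have h2 := hf1.continuous_fderiv one_ne_zero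
  obtain ⟨C, h0, hC⟩ := exists_bound_of_hasCompactSupport h2 ((hc.fderiv ℝ).fderiv ℝ)
  refine ⟨fun t => ∫ θ, fderiv ℝ (fderiv ℝ f) (z + t • (θ : E3)) (θ : E3) (θ : E3) ∂sigma,
    continuous_sphere_integral (by fun_prop), fun t => ?_⟩
  refine hasDerivAt_sphere_integral (C := C)
    (a := fun t θ => fderiv ℝ f (z + t • (θ : E3)) (θ : E3))
    (a' := fun t θ => fderiv ℝ (fderiv ℝ f) (z + t • (θ : E3)) (θ : E3) (θ : E3))
    (fun t => by fun_prop) (fun t => by fun_prop) (fun t θ => ?_) (fun t θ => ?_) t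
  · have := (fderiv ℝ (fderiv ℝ f) (z + t • (θ : E3))).le_opNorm₂ (θ : E3) (θ : E3)
    rw [norm_coe_sphere, mul_one, mul_one] at this
    exact this.trans (hC _)
  · have h3 : HasDerivAt (fun t : ℝ => z + t • (θ : E3)) (θ : E3) t := by
      simpa using ((hasDerivAt_id t).smul_const (θ : E3)).const_add z
    have h4 := ((hf1.differentiable one_ne_zero _).hasFDerivAt).comp_hasDerivAt t h3
    exact h4.clm_apply (hasDerivAt_const t (θ : E3)) |>.congr_deriv (by simp)

section Support

variable {R : ℝ} (hR : 0 < R) {f : E3 → ℝ} (hf : Continuous f)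
  (hsupp : Function.support f ⊆ Metric.closedBall (0 : E3) R) {z : E3} (hz : ‖z‖ = R)
include hR hf hsupp hz

theorem sMean_zero : sMean f z 0 = 0 := by
  simp [sMean, eq_zero_of_le_norm hR hf hsupp hz.ge]

theorem sMean_eq_zero_of_le {t : ℝ} (ht : 2 * R ≤ t) : sMean f z t = 0 := by
  refine integral_eq_zero_of_ae (ae_of_all _ fun θ => eq_zero_of_le_norm hR hf hsupp ?_)
  have := norm_sub_norm_le (t • (θ : E3)) (-z)
  rw [norm_smul, norm_coe_sphere, norm_neg, hz, mul_one, sub_neg_eq_add,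
    Real.norm_of_nonneg (by linarith), add_comm] at this
  linarith

end Support

/-! ### The filtration step in closed form -/

/-- The closed form of the filtration step, with the required convergence statements. -/
theorem filterAbel_tendsto_and_integrable {R : ℝ} (hR : 0 < R) {f : E3 → ℝ} (hf : ContDiff ℝ 1 f)
    (hsupp : Function.support f ⊆ Metric.closedBall (0 : E3) R) {z : E3} (hz : ‖z‖ = R)
    {t : ℝ} (ht : 0 < t) :
    (∀ ε : ℝ, 0 < ε → IntegrableOn
      (fun l => Real.exp (-(ε * l)) * filterIntegrand R (sphInt f z) t l) (Ioi 0)) ∧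
    Tendsto (filterAbel R (sphInt f z) t) (𝓝[>] 0)
      (𝓝 (-(2 / t) * quotDeriv (sphInt f z) t)) ∧
    (∀ L : ℝ, Tendsto (fun Λ : ℝ => ∫ l in (0 : ℝ)..Λ, filterIntegrand R (sphInt f z) t l)
      atTop (𝓝 L) → Tendsto (filterAbel R (sphInt f z) t) (𝓝[>] 0) (𝓝 L)) ∧
    (ContDiff ℝ 2 f → IntegrableOn (filterIntegrand R (sphInt f z) t) (Ioi 0)) := by
  have hc : HasCompactSupport f :=
    HasCompactSupport.of_support_subset_isCompact (isCompact_closedBall _ _) hsupp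
  set v : ℝ → ℝ := fun s => s * sMean f z s with hv
  set k : ℝ → ℝ := fun s => sMean f z s + s * sMeanD f z s with hk
  have hvd : ∀ s, HasDerivAt v (k s) s := hasDerivAt_mul_sMean hf hc z
  have hkc : Continuous k := by
    have h1 := (continuous_sMean hf).comp (Continuous.prodMk_right z)
    have h2 := (continuous_sMeanD hf).comp (Continuous.prodMk_right z)
    exact h1.add (continuous_id.mul h2)
  have hk0 : k 0 = 0 := by simp [hk, sMean_zero hR hf.continuous hsupp hz]
  have hv1 : ∀ s, 2 * R ≤ s → v s = 0 := fun s hs => by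
    simp [hv, sMean_eq_zero_of_le hR hf.continuous hsupp hz hs]
  -- Beyond 2R the function v is locally zero, so its derivative is too; continuity of k then
  -- reaches the endpoint 2R.
  have hk1 : ∀ s, 2 * R ≤ s → k s = 0 := by
    have h1 : EqOn k (fun _ => 0) (Ioi (2 * R)) := by
      intro s hs
      have h2 : HasDerivAt v 0 s := (hasDerivAt_const s (0 : ℝ)).congr_of_eventuallyEq (by
        filter_upwards [lt_mem_nhds hs] with x hx using hv1 x hx.le)
      exact (hvd s).unique h2
    intro s hs
    refine h1.closure hkc continuous_const ?_
    rwa [closure_Ioi]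
  set T : ℝ → ℝ := fun l => ∫ s in (0 : ℝ)..(2 * R), Real.cos (l * (t - s)) * k s with hT
  have hTc : Continuous T :=
    intervalIntegral.continuous_parametric_intervalIntegral_of_continuous' (by fun_prop) _ _
  obtain ⟨C, hC⟩ := (isCompact_Icc (a := (0 : ℝ)) (b := 2 * R)).exists_bound_of_continuousOn
    hkc.continuousOn
  have hTb : ∀ l, |T l| ≤ C * (2 * R) := by
    intro l
    have := intervalIntegral.norm_integral_le_of_norm_le_const (a := 0) (b := 2 * R) (C := C)
      (f := fun s => Real.cos (l * (t - s)) * k s) ?_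
    · rwa [sub_zero, abs_of_pos (by positivity)] at this
    · intro s hs
      rw [uIoc_of_le (by positivity)] at hs
      rw [norm_mul]
      exact (mul_le_of_le_one_left (norm_nonneg _) (Real.abs_cos_le_one _)).trans
        (hC s (Ioc_subset_Icc_self hs))
  set c : ℝ := -(2 / (Real.pi * t)) with hcdef
  have hF : ∀ l, 0 ≤ l → filterIntegrand R (sphInt f z) t l = c * T l := fun l hl =>
    filterIntegrand_eq_cos hR ht hl hkc hvd (fun s _ => sphInt_eq f z s) (by simp [hv])
      (hv1 _ le_rfl)
  have hcT : ∀ l, |c * T l| ≤ |c| * (C * (2 * R)) := fun l => by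
    rw [abs_mul]; exact mul_le_mul_of_nonneg_left (hTb l) (abs_nonneg c)
  have hA : filterAbel R (sphInt f z) t =
      fun ε => ∫ l in Ioi (0 : ℝ), Real.exp (-(ε * l)) * (c * T l) := by
    funext ε
    exact setIntegral_congr_fun measurableSet_Ioi fun l hl => by
      simp only [hF l (le_of_lt hl)]
  refine ⟨fun ε hε => ?_, ?_, fun L hL => ?_, fun hf2 => ?_⟩
  · refine (integrableOn_exp_mul_bdd hε (hTc.const_mul c) fun l _ => hcT l).congr_fun
      (fun l hl => ?_) measurableSet_Ioi
    simp only [hF l (le_of_lt hl)]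
  · rw [hA, quotDeriv_eq hf hc z ht]
    have h1 := (tendsto_intervalIntegral_poisson (by positivity : 0 < 2 * R) ht hkc hk0
      hk1).const_mul c
    rw [show c * (Real.pi * k t) = -(2 / t) * (sMean f z t + t * sMeanD f z t) by
      simp only [hcdef, hk]; field_simp] at h1
    refine h1.congr' ?_
    filter_upwards [self_mem_nhdsWithin] with ε hε
    have h2 := integral_exp_mul_intervalIntegral_swap (W := |c|) hε
      (by positivity : 0 ≤ 2 * R) (w := fun _ => c) continuous_const (fun _ _ => le_rfl) hkc
      (q := fun l s => Real.cos (l * (t - s))) (by fun_prop) (fun _ _ => Real.abs_cos_le_one _)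
    rw [h2, ← intervalIntegral.integral_const_mul]
    refine intervalIntegral.integral_congr fun s _ => ?_
    rw [← integral_exp_mul_cos hε, ← mul_assoc, ← integral_const_mul]
    congr 1
    exact integral_congr_ae (ae_of_all _ fun l => by ring)
  · rw [hA]
    refine tendsto_laplace_of_tendsto (hTc.const_mul c) hcT (hL.congr' ?_)
    filter_upwards [eventually_ge_atTop 0] with x hx
    refine intervalIntegral.integral_congr fun l hl => ?_
    rw [uIcc_of_le hx] at hl
    exact hF l hl.1
  · obtain ⟨m, hmc, hm⟩ := exists_hasDerivAt_sMeanD hf2 hc z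
    set k' : ℝ → ℝ := fun s => sMeanD f z s + (sMeanD f z s + s * m s) with hk'
    have hkd : ∀ s, HasDerivAt k (k' s) s := fun s =>
      ((hasDerivAt_sMean hf hc z s).add ((hasDerivAt_id s).mul (hm s))).congr_deriv
        (by simp [hk'])
    have hk'c : Continuous k' := by
      have h2 : Continuous (sMeanD f z) := (continuous_sMeanD hf).comp (Continuous.prodMk_right z)
      fun_prop
    set S : ℝ → ℝ := fun l => ∫ s in (0 : ℝ)..(2 * R), Real.sin (l * (t - s)) * k' s with hS
    have hSc : Continuous S :=
      intervalIntegral.continuous_parametric_intervalIntegral_of_continuous' (by fun_prop) _ _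
    -- The second integration by parts; there is no boundary term because k vanishes at 0 and at 2R.
    have hTS : ∀ l, l ≠ 0 → T l = S l / l := by
      intro l hl
      rw [eq_div_iff hl, hT, ← intervalIntegral.integral_mul_const]
      have := intervalIntegral.integral_deriv_mul_eq_sub (a := 0) (b := 2 * R)
        (u := fun s => Real.sin (l * (t - s))) (u' := fun s => -(l * Real.cos (l * (t - s))))
        (v := k) (v' := k') ?_ (fun s _ => hkd s)
        (Continuous.intervalIntegrable (by fun_prop) _ _)
        (Continuous.intervalIntegrable (by fun_prop) _ _)
      · rw [hk0, hk1 _ le_rfl, mul_zero, mul_zero, sub_zero, intervalIntegral.integral_add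
          (Continuous.intervalIntegrable (by fun_prop) _ _)
          (Continuous.intervalIntegrable (by fun_prop) _ _)] at this
        have h3 : ∫ s in (0 : ℝ)..(2 * R), -(l * Real.cos (l * (t - s))) * k s =
            -∫ s in (0 : ℝ)..(2 * R), Real.cos (l * (t - s)) * k s * l := by
          rw [← intervalIntegral.integral_neg]
          exact intervalIntegral.integral_congr fun s _ => by ring
        rw [h3] at this
        change -_ + S l = 0 at this
        change _ = S l
        linarith
      · intro s _
        have := (((hasDerivAt_id s).const_sub t).const_mul l).sin
        simpa [mul_comm] using this
    have hS2 := integrableOn_sq_sineTransform (by positivity : 0 ≤ 2 * R) t hk'c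
    have hpow : IntegrableOn (fun l : ℝ => l ^ (-2 : ℝ)) (Ioi 1) :=
      integrableOn_Ioi_rpow_of_lt (by norm_num) one_pos
    -- On (1, ∞), |S|/l is at most l⁻² + S², and both terms are integrable.
    have hT1 : IntegrableOn T (Ioi 1) := by
      refine Integrable.mono' (hpow.add (hS2.mono_set (Ioi_subset_Ioi zero_le_one)))
        hTc.aestronglyMeasurable ?_
      refine (ae_restrict_mem measurableSet_Ioi).mono fun l hl => ?_
      have hl0 : (0 : ℝ) < l := one_pos.trans hl
      rw [hTS l hl0.ne', Real.norm_eq_abs, abs_div, abs_of_pos hl0]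
      simp only [Pi.add_apply]
      rw [Real.rpow_neg hl0.le, Real.rpow_ofNat, div_eq_mul_inv, ← inv_pow]
      change |S l| * l⁻¹ ≤ l⁻¹ ^ 2 + S l ^ 2
      rw [← sq_abs (S l)]
      nlinarith [sq_nonneg (|S l| - l⁻¹), sq_nonneg (|S l|), sq_nonneg (l⁻¹)]
    have hT0 : IntegrableOn T (Ioi 0) := by
      rw [← Ioc_union_Ioi_eq_Ioi zero_le_one]
      exact (hTc.integrableOn_Icc.mono_set Ioc_subset_Icc_self).union hT1
    exact IntegrableOn.congr_fun (hT0.const_mul c) (fun l hl => (hF l (le_of_lt hl)).symm) measurableSet_Ioi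

/-! ### Polar coordinates, invariance of the surface measure and Archimedes' theorem -/

/-- Integration in polar coordinates. -/
theorem lintegral_polar {F : E3 → ℝ≥0∞} (hF : Measurable F) :
    ∫⁻ x, F x = ∫⁻ θ : Metric.sphere (0 : E3) 1, (∫⁻ r in Ioi (0 : ℝ),
      ENNReal.ofReal (r ^ 2) * F (r • (θ : E3))) ∂sigma := by
  have hdim : Module.finrank ℝ E3 - 1 = 2 := by simp
  have h1 := (volume : Measure E3).measurePreserving_homeomorphUnitSphereProd.symm
    (homeomorphUnitSphereProd E3).toMeasurableEquiv
  rw [hdim] at h1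
  have h2 := h1.lintegral_comp (f := fun x => F x) (hF.comp measurable_subtype_coe)
  rw [lintegral_subtype_comap (measurableSet_singleton _).compl F, restrict_compl_singleton] at h2
  rw [← h2, lintegral_prod _ (by
    refine (hF.comp (measurable_subtype_coe.comp ?_)).aemeasurable
    exact (homeomorphUnitSphereProd E3).toMeasurableEquiv.symm.measurable)]
  refine lintegral_congr fun θ => ?_
  rw [Measure.volumeIoiPow, lintegral_withDensity_eq_lintegral_mul _ (by fun_prop) (by
    refine hF.comp (measurable_subtype_coe.comp ?_)
    exact (homeomorphUnitSphereProd E3).toMeasurableEquiv.symm.measurable.comp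
      measurable_prodMk_left)]
  exact lintegral_subtype_comap measurableSet_Ioi
    (fun r => ENNReal.ofReal (r ^ 2) * F (r • (θ : E3)))

/-- The mass of the radial weight used to pass between the sphere and the ball. -/
def ballWeight : ℝ≥0∞ := ∫⁻ r in Ioi (0 : ℝ), ENNReal.ofReal (r ^ 2) * (Iio (1 : ℝ)).indicator 1 r

theorem ballWeight_eq : ballWeight = ENNReal.ofReal (1 / 3) := by
  have h : ∀ r : ℝ, ENNReal.ofReal (r ^ 2) * (Iio (1 : ℝ)).indicator 1 r =
      (Iio (1 : ℝ)).indicator (fun r => ENNReal.ofReal (r ^ 2)) r := fun r => by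
    by_cases hr : r < 1 <;> simp [hr]
  simp_rw [ballWeight, h]
  rw [setLIntegral_indicator measurableSet_Iio, Iio_inter_Ioi,
    setLIntegral_congr Ioo_ae_eq_Ioc, ← ofReal_integral_eq_lintegral_ofReal,
    ← intervalIntegral.integral_of_le zero_le_one, integral_pow]
  · norm_num
  · exact (continuous_pow 2).integrableOn_Icc.mono_set Ioc_subset_Icc_self
  · exact ae_of_all _ fun r => sq_nonneg r

/-- A sphere integral is, up to a constant, the integral over the unit ball of the extension of
degree zero. Facts about the surface measure can thus be read off from Lebesgue measure. -/
theorem ballWeight_mul_lintegral_sphere {φ : E3 → ℝ≥0∞} (hφ : Measurable φ) :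
    ballWeight * ∫⁻ θ : Metric.sphere (0 : E3) 1, φ θ ∂sigma =
      ∫⁻ x : E3, (Iio (1 : ℝ)).indicator 1 ‖x‖ * φ (‖x‖⁻¹ • x) := by
  have hm : Measurable ((Iio (1 : ℝ)).indicator (1 : ℝ → ℝ≥0∞)) :=
    measurable_one.indicator measurableSet_Iio
  rw [lintegral_polar (by fun_prop), ← lintegral_const_mul _ (by fun_prop)]
  refine lintegral_congr fun θ => ?_
  rw [ballWeight, ← lintegral_mul_const _ (by fun_prop)]
  refine setLIntegral_congr_fun measurableSet_Ioi fun r hr => ?_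
  have hr : 0 < r := hr
  rw [norm_smul, norm_coe_sphere, mul_one, Real.norm_of_nonneg hr.le, smul_smul,
    inv_mul_cancel₀ hr.ne', one_smul, mul_assoc]

theorem eq_of_ballWeight_mul_eq {a b : ℝ≥0∞} (h : ballWeight * a = ballWeight * b) : a = b := by
  refine (ENNReal.mul_right_inj ?_ ?_).1 h
  · rw [ballWeight_eq]; simp
  · rw [ballWeight_eq]; simp

theorem lintegral_sphere_comp_isometry (U : E3 ≃ₗᵢ[ℝ] E3) {φ : E3 → ℝ≥0∞} (hφ : Measurable φ) :
    ∫⁻ θ : Metric.sphere (0 : E3) 1, φ (U θ) ∂sigma =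
      ∫⁻ θ : Metric.sphere (0 : E3) 1, φ θ ∂sigma := by
  have hU : Measurable U := U.continuous.measurable
  have hm : Measurable ((Iio (1 : ℝ)).indicator (1 : ℝ → ℝ≥0∞)) :=
    measurable_one.indicator measurableSet_Iio
  apply eq_of_ballWeight_mul_eq
  rw [ballWeight_mul_lintegral_sphere hφ, ballWeight_mul_lintegral_sphere (φ := fun x => φ (U x)) (hφ.comp hU),
    ← U.measurePreserving.lintegral_comp
      (f := fun x => (Iio (1 : ℝ)).indicator 1 ‖x‖ * φ (‖x‖⁻¹ • x)) (by fun_prop)]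
  simp

/-- The surface measure is invariant under linear isometries. -/
theorem integral_sphere_comp_isometry {V : Type*} [NormedAddCommGroup V] [NormedSpace ℝ V]
    (U : E3 ≃ₗᵢ[ℝ] E3) {φ : E3 → V} (hφ : StronglyMeasurable φ) :
    ∫ θ : Metric.sphere (0 : E3) 1, φ (U θ) ∂sigma =
      ∫ θ : Metric.sphere (0 : E3) 1, φ θ ∂sigma := by
  have hU : Measurable U := U.continuous.measurable
  have h : (sigma.map Subtype.val).map U = sigma.map Subtype.val := by
    ext s hs
    have h1 : Measurable (s.indicator (1 : E3 → ℝ≥0∞)) := measurable_one.indicator hs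
    rw [← lintegral_indicator_one hs, ← lintegral_indicator_one hs, lintegral_map h1 hU,
      lintegral_map (f := fun x => s.indicator 1 (U x)) (h1.comp hU) measurable_subtype_coe,
      lintegral_map h1 measurable_subtype_coe]
    exact lintegral_sphere_comp_isometry U h1
  have h2 := integral_map (μ := sigma.map Subtype.val) hU.aemeasurable
    (f := φ) hφ.aestronglyMeasurable
  rw [h, integral_map measurable_subtype_coe.aemeasurable hφ.aestronglyMeasurable,
    integral_map (f := fun x => φ (U x)) measurable_subtype_coe.aemeasurable
      (hφ.comp_measurable hU).aestronglyMeasurable] at h2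
  exact h2.symm

/-- Integration of axially symmetric functions on the plane. -/
theorem lintegral_plane_radial {k : ℝ → ℝ≥0∞} (hk : Measurable k) :
    ∫⁻ b : ℝ × ℝ, k (b.1 ^ 2 + b.2 ^ 2) =
      ENNReal.ofReal (2 * Real.pi) * ∫⁻ r in Ioi (0 : ℝ), ENNReal.ofReal r * k (r ^ 2) := by
  rw [← lintegral_comp_polarCoord_symm, polarCoord_target, Measure.volume_eq_prod,
    ← Measure.prod_restrict]
  simp only [polarCoord_symm_apply, smul_eq_mul]
  have h : ∀ p : ℝ × ℝ, (p.1 * Real.cos p.2) ^ 2 + (p.1 * Real.sin p.2) ^ 2 = p.1 ^ 2 := fun p => by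
    rw [mul_pow, mul_pow, ← mul_add, Real.cos_sq_add_sin_sq, mul_one]
  simp_rw [h]
  rw [lintegral_prod _ (by fun_prop), mul_comm, ← lintegral_mul_const _ (by fun_prop)]
  refine lintegral_congr fun r => ?_
  simp only
  rw [lintegral_const, Measure.restrict_apply_univ, Real.volume_Ioo]
  congr 2
  ring

/-- Integration of axially symmetric functions on space, in spherical coordinates. -/
theorem lintegral_axial {K : ℝ → ℝ → ℝ≥0∞} (hK : Measurable (Function.uncurry K)) :
    ∫⁻ x : E3, K (x 0) ‖x‖ = ENNReal.ofReal (2 * Real.pi) *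
      ∫⁻ r in Ioi (0 : ℝ), ∫⁻ α in Ioo (-Real.pi) Real.pi,
        ENNReal.ofReal r * (ENNReal.ofReal (r * Real.sin α) * K (r * Real.cos α) r) := by
  have hK2 : ∀ {X : Type} [MeasurableSpace X] {f g : X → ℝ}, Measurable f → Measurable g →
      Measurable fun x => K (f x) (g x) := fun hf hg => hK.comp (hf.prodMk hg)
  -- Split off the axis coordinate and use plane polar coordinates twice: in the orthogonal plane,
  -- then in the half plane of axis coordinate and distance to the axis.
  have e1 := (EuclideanSpace.volume_preserving_symm_measurableEquiv_toLp (Fin 3))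
  have e2 := (volume_preserving_piFinSuccAbove (fun _ : Fin 3 => ℝ) 0)
  have e3 := (MeasurePreserving.id (volume : Measure ℝ)).prod (volume_preserving_finTwoArrow ℝ)
  have e := e3.comp (e2.comp e1)
  have h1 := e.lintegral_comp
    (f := fun p : ℝ × (ℝ × ℝ) => K p.1 √(p.1 ^ 2 + (p.2.1 ^ 2 + p.2.2 ^ 2)))
    (hK2 (by fun_prop) (by fun_prop))
  have h2 : ∀ x : E3, K (x 0) ‖x‖ = (fun p : ℝ × (ℝ × ℝ) =>
      K p.1 √(p.1 ^ 2 + (p.2.1 ^ 2 + p.2.2 ^ 2))) ((Prod.map id MeasurableEquiv.finTwoArrow ∘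
        (MeasurableEquiv.piFinSuccAbove (fun _ : Fin 3 => ℝ) 0) ∘
        (MeasurableEquiv.toLp 2 (Fin 3 → ℝ)).symm) x) := by
    intro x
    rw [EuclideanSpace.norm_eq, Fin.sum_univ_three]
    simp only [Real.norm_eq_abs, sq_abs]
    rw [add_assoc]
    rfl
  simp_rw [h2]
  rw [h1, lintegral_prod _ (hK2 (by fun_prop) (by fun_prop)).aemeasurable]
  have h3 : ∀ a : ℝ, ∫⁻ b : ℝ × ℝ, K a √(a ^ 2 + (b.1 ^ 2 + b.2 ^ 2)) =
      ENNReal.ofReal (2 * Real.pi) *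
        ∫⁻ r in Ioi (0 : ℝ), ENNReal.ofReal r * K a √(a ^ 2 + r ^ 2) := fun a =>
    lintegral_plane_radial (k := fun q => K a √(a ^ 2 + q)) (hK2 (by fun_prop) (by fun_prop))
  -- `ENNReal.ofReal r` vanishes for r ≤ 0, so the half plane may be enlarged to the whole plane
  -- before the second polar change of variables.
  have h4 : ∀ a : ℝ, ∫⁻ r in Ioi (0 : ℝ), ENNReal.ofReal r * K a √(a ^ 2 + r ^ 2) =
      ∫⁻ r : ℝ, ENNReal.ofReal r * K a √(a ^ 2 + r ^ 2) := by
    intro a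
    refine setLIntegral_eq_of_support_subset fun r hr => ?_
    by_contra hr0
    exact hr (by simp only; rw [ENNReal.ofReal_of_nonpos (not_lt.1 hr0), zero_mul])
  simp_rw [h3, h4]
  have hm : Measurable fun p : ℝ × ℝ => ENNReal.ofReal p.2 * K p.1 √(p.1 ^ 2 + p.2 ^ 2) :=
    Measurable.mul (by fun_prop) (hK2 (by fun_prop) (by fun_prop))
  rw [lintegral_const_mul _ hm.lintegral_prod_right']
  congr 1
  rw [← lintegral_prod (μ := volume) (ν := volume)
    (fun p : ℝ × ℝ => ENNReal.ofReal p.2 * K p.1 √(p.1 ^ 2 + p.2 ^ 2)) hm.aemeasurable,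
    ← Measure.volume_eq_prod, ← lintegral_comp_polarCoord_symm, polarCoord_target,
    Measure.volume_eq_prod, ← Measure.prod_restrict]
  simp only [polarCoord_symm_apply, smul_eq_mul]
  have h : ∀ p : ℝ × ℝ, (p.1 * Real.cos p.2) ^ 2 + (p.1 * Real.sin p.2) ^ 2 = p.1 ^ 2 := fun p => by
    rw [mul_pow, mul_pow, ← mul_add, Real.cos_sq_add_sin_sq, mul_one]
  simp_rw [h]
  have hm' : Measurable fun p : ℝ × ℝ => ENNReal.ofReal p.1 * (ENNReal.ofReal
      (p.1 * Real.sin p.2) * K (p.1 * Real.cos p.2) √(p.1 ^ 2)) :=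
    Measurable.mul (by fun_prop) (Measurable.mul (by fun_prop)
      (hK2 (by fun_prop) (by fun_prop)))
  rw [lintegral_prod _ hm'.aemeasurable]
  refine setLIntegral_congr_fun measurableSet_Ioi fun r hr => ?_
  simp only [Real.sqrt_sq (le_of_lt hr)]

/-- Where the sine is negative `ENNReal.ofReal` gives 0, so only (0, π) contributes, and there u =
cos α is a bijective substitution. -/
theorem lintegral_sin_mul_comp_cos (φ : ℝ → ℝ≥0∞) :
    ∫⁻ α in Ioo (-Real.pi) Real.pi, ENNReal.ofReal (Real.sin α) * φ (Real.cos α) =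
      ∫⁻ u in Icc (-1 : ℝ) 1, φ u := by
  rw [← Real.bijOn_cos.image_eq, lintegral_image_eq_lintegral_abs_deriv_mul measurableSet_Icc
    (fun x _ => (Real.hasDerivAt_cos x).hasDerivWithinAt) Real.injOn_cos,
    ← setLIntegral_congr Ioo_ae_eq_Icc]
  have hd : Ioo (-Real.pi) Real.pi = Ioc (-Real.pi) 0 ∪ Ioo 0 Real.pi :=
    (Ioc_union_Ioo_eq_Ioo (by linarith [Real.pi_pos]) Real.pi_pos).symm
  rw [hd, lintegral_union measurableSet_Ioo (by
    rw [Set.disjoint_left]; exact fun x hx hy => absurd hx.2 (not_le.2 hy.1))]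
  have h0 : ∫⁻ α in Ioc (-Real.pi) 0, ENNReal.ofReal (Real.sin α) * φ (Real.cos α) = 0 := by
    rw [← lintegral_zero (μ := volume.restrict (Ioc (-Real.pi) 0))]
    refine setLIntegral_congr_fun measurableSet_Ioc fun α hα => ?_
    rw [ENNReal.ofReal_of_nonpos (Real.sin_nonpos_of_nonpos_of_neg_pi_le hα.2 hα.1.le), zero_mul]
  rw [h0, zero_add]
  refine setLIntegral_congr_fun measurableSet_Ioo fun α hα => ?_
  simp only [abs_neg]
  rw [abs_of_pos (Real.sin_pos_of_mem_Ioo hα)]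

theorem lintegral_sphere_coord {φ : ℝ → ℝ≥0∞} (hφ : Measurable φ) :
    ∫⁻ θ : Metric.sphere (0 : E3) 1, φ ((θ : E3) 0) ∂sigma =
      ENNReal.ofReal (2 * Real.pi) * ∫⁻ u in Icc (-1 : ℝ) 1, φ u := by
  have hm : Measurable ((Iio (1 : ℝ)).indicator (1 : ℝ → ℝ≥0∞)) :=
    measurable_one.indicator measurableSet_Iio
  apply eq_of_ballWeight_mul_eq
  rw [ballWeight_mul_lintegral_sphere (φ := fun x => φ (x 0)) (by fun_prop)]
  have := lintegral_axial (K := fun a r => (Iio (1 : ℝ)).indicator 1 r * φ (r⁻¹ * a))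
    (by unfold Function.uncurry; fun_prop)
  simp only [PiLp.smul_apply, smul_eq_mul]
  rw [this, mul_left_comm]
  congr 1
  rw [ballWeight, ← lintegral_mul_const _ (by fun_prop)]
  refine setLIntegral_congr_fun measurableSet_Ioi fun r hr => ?_
  have hr : 0 < r := hr
  rw [← lintegral_sin_mul_comp_cos, ← lintegral_const_mul _ (by fun_prop)]
  refine lintegral_congr fun α => ?_
  rw [inv_mul_cancel_left₀ hr.ne', ENNReal.ofReal_mul hr.le, sq, ENNReal.ofReal_mul hr.le]
  ring

/-- Archimedes' theorem: the projection of the surface measure to an axis is uniform. -/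
theorem map_inner_sigma {e : E3} (he : ‖e‖ = 1) :
    sigma.map (fun θ : Metric.sphere (0 : E3) 1 => inner ℝ e (θ : E3)) =
      ENNReal.ofReal (2 * Real.pi) • volume.restrict (Icc (-1 : ℝ) 1) := by
  have hU : ‖e‖ = ‖(EuclideanSpace.single 0 1 : E3)‖ := by simp [he]
  -- The reflection exchanging e with the first basis vector reduces to the coordinate case.
  set U := (Submodule.reflection (Submodule.span ℝ {e - EuclideanSpace.single 0 1})ᗮ : E3 ≃ₗᵢ[ℝ] E3)
  have hUe : U e = EuclideanSpace.single 0 1 := Submodule.reflection_sub hU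
  have hcont : Measurable fun θ : Metric.sphere (0 : E3) 1 => inner ℝ e (θ : E3) :=
    Continuous.measurable (by fun_prop)
  ext s hs
  have h1 : Measurable (s.indicator (1 : ℝ → ℝ≥0∞)) := measurable_one.indicator hs
  rw [← lintegral_indicator_one hs, ← lintegral_indicator_one hs, lintegral_map h1 hcont,
    lintegral_smul_measure, smul_eq_mul, ← lintegral_sphere_coord h1,
    ← lintegral_sphere_comp_isometry U (φ := fun x => s.indicator 1 (x 0)) (by fun_prop)]
  refine lintegral_congr fun θ => ?_
  have : inner ℝ e (θ : E3) = (U θ) 0 := by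
    rw [← U.inner_map_map, hUe, EuclideanSpace.inner_single_left]
    simp
  rw [this]

/-- The vector area of a spherical cap. -/
theorem integral_cap {e : E3} (he : ‖e‖ = 1) (h : ℝ) :
    ∫ θ : Metric.sphere (0 : E3) 1, (Ioi h).indicator (1 : ℝ → ℝ) (inner ℝ e (θ : E3)) • (θ : E3)
      ∂sigma = (Real.pi * max 0 (1 - h ^ 2)) • e := by
  set I := ∫ θ : Metric.sphere (0 : E3) 1,
    (Ioi h).indicator (1 : ℝ → ℝ) (inner ℝ e (θ : E3)) • (θ : E3) ∂sigma with hI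
  have hm : Measurable ((Ioi h).indicator (1 : ℝ → ℝ)) := measurable_one.indicator measurableSet_Ioi
  have hb : ∀ u, ‖(Ioi h).indicator (1 : ℝ → ℝ) u‖ ≤ 1 := fun u => by
    by_cases hu : h < u <;> simp [hu]
  have hc : Continuous fun x : E3 => inner ℝ e x := by fun_prop
  have hmE : Measurable fun x : E3 => (Ioi h).indicator (1 : ℝ → ℝ) (inner ℝ e x) :=
    hm.comp hc.measurable
  have hint : Integrable (fun θ : Metric.sphere (0 : E3) 1 =>
      (Ioi h).indicator (1 : ℝ → ℝ) (inner ℝ e (θ : E3)) • (θ : E3)) sigma :=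
    (integrable_sphere continuous_subtype_val).bdd_smul 1
      (hmE.comp measurable_subtype_coe).aestronglyMeasurable (ae_of_all _ fun θ => hb _)
  have hint2 : Integrable (fun θ : Metric.sphere (0 : E3) 1 =>
      (Ioi h).indicator (1 : ℝ → ℝ) (inner ℝ e (θ : E3)) * inner ℝ e (θ : E3)) sigma :=
    (integrable_sphere (by fun_prop)).bdd_mul
      (hmE.comp measurable_subtype_coe).aestronglyMeasurable (ae_of_all _ fun θ => hb _)
  have hJ : ∫ θ : Metric.sphere (0 : E3) 1,
      (Ioi h).indicator (1 : ℝ → ℝ) (inner ℝ e (θ : E3)) * inner ℝ e (θ : E3) ∂sigma =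
      Real.pi * max 0 (1 - h ^ 2) := by
    rw [← integral_map (μ := sigma) (φ := fun θ : Metric.sphere (0 : E3) 1 => inner ℝ e (θ : E3))
      (f := fun u => (Ioi h).indicator (1 : ℝ → ℝ) u * u)
      (Continuous.aemeasurable (by fun_prop)) (by fun_prop), map_inner_sigma he,
      integral_smul_measure, ENNReal.toReal_ofReal (by positivity)]
    have h1 : ∀ u, (Ioi h).indicator (1 : ℝ → ℝ) u * u = (Ioi h).indicator id u := fun u => by
      by_cases hu : h < u <;> simp [hu]
    simp_rw [h1]
    rw [setIntegral_indicator measurableSet_Ioi, smul_eq_mul]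
    rcases lt_or_ge h (-1) with h2 | h2
    · rw [inter_eq_left.2 (show Icc (-1) 1 ⊆ Ioi h from fun u hu => h2.trans_le hu.1), max_eq_left (by nlinarith),
        integral_Icc_eq_integral_Ioc, ← intervalIntegral.integral_of_le (by norm_num)]
      simp
    rcases le_or_gt h 1 with h3 | h3
    · have h4 : Icc (-1) 1 ∩ Ioi h = Ioc h 1 := by
        ext u
        exact ⟨fun hu => ⟨hu.2, hu.1.2⟩, fun hu => ⟨⟨h2.trans hu.1.le, hu.2⟩, hu.1⟩⟩
      rw [h4, max_eq_right (by nlinarith), ← intervalIntegral.integral_of_le h3]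
      simp only [id_eq, integral_id]
      ring
    · have h4 : Icc (-1) 1 ∩ Ioi h = ∅ := by
        ext u
        exact ⟨fun hu => absurd (h3.trans hu.2) (not_lt.2 hu.1.2), fun hu => hu.elim⟩
      rw [h4, max_eq_left (by nlinarith)]
      simp
  -- Reflection in the axis through e preserves the cap and sends θ to 2⟨e,θ⟩e - θ. Invariance gives
  -- I = 2Je - I with J the scalar integral just computed, hence I = Je.
  set U := (Submodule.reflection (Submodule.span ℝ {e}) : E3 ≃ₗᵢ[ℝ] E3)
  have hU : ∀ x, U x = (2 * inner ℝ e x) • e - x := fun x => by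
    rw [Submodule.reflection_apply, Submodule.starProjection_unit_singleton ℝ he, two_mul, add_smul,
      two_smul]
  have hUi : ∀ x, inner ℝ e (U x) = inner ℝ e x := fun x => by
    rw [hU, inner_sub_right, inner_smul_right, real_inner_self_eq_norm_sq, he]
    ring
  have key := integral_sphere_comp_isometry U
    (φ := fun x => (Ioi h).indicator (1 : ℝ → ℝ) (inner ℝ e x) • x)
    (hmE.stronglyMeasurable.smul stronglyMeasurable_id)
  simp only [hUi] at key
  simp only [hU, smul_sub, smul_smul] at key
  have h5 : Integrable (fun θ : Metric.sphere (0 : E3) 1 =>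
      ((Ioi h).indicator (1 : ℝ → ℝ) (inner ℝ e (θ : E3)) * (2 * inner ℝ e (θ : E3))) • e) sigma := by
    refine ((hint2.const_mul 2).smul_const e).congr (ae_of_all _ fun θ => ?_)
    simp only
    congr 1
    ring
  rw [integral_sub h5 hint, integral_smul_const, ← hI, sub_eq_iff_eq_add, ← two_smul ℝ I] at key
  have h6 : ∫ θ : Metric.sphere (0 : E3) 1,
      (Ioi h).indicator (1 : ℝ → ℝ) (inner ℝ e (θ : E3)) * (2 * inner ℝ e (θ : E3)) ∂sigma =
      2 * (Real.pi * max 0 (1 - h ^ 2)) := by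
    rw [← hJ, ← integral_const_mul]
    exact integral_congr_ae (ae_of_all _ fun θ => by ring)
  rw [h6, mul_smul] at key
  exact (smul_right_injective E3 (two_ne_zero (α := ℝ)) key).symm

/-- Integration in polar coordinates, for vector-valued functions. -/
theorem integral_polar {V : Type*} [NormedAddCommGroup V] [NormedSpace ℝ V] {F : E3 → V}
    (hF : StronglyMeasurable F) :
    ∫ x, F x = ∫ p : Metric.sphere (0 : E3) 1 × ℝ, p.2 ^ 2 • F (p.2 • (p.1 : E3))
      ∂(sigma.prod (volume.restrict (Ioi 0))) := by
  set ν := (sigma.prod (volume.restrict (Ioi (0 : ℝ)))).withDensity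
    fun p => ENNReal.ofReal (p.2 ^ 2) with hν
  have hΨ : Measurable fun p : Metric.sphere (0 : E3) 1 × ℝ => p.2 • (p.1 : E3) :=
    Continuous.measurable (by fun_prop)
  have hd : Measurable fun p : Metric.sphere (0 : E3) 1 × ℝ => ENNReal.ofReal (p.2 ^ 2) := by
    fun_prop
  -- Identifying Lebesgue measure as a push-forward transfers the formula to Bochner integrals with
  -- no integrability condition.
  have hmap : ν.map (fun p => p.2 • (p.1 : E3)) = volume := by
    ext s hs
    have h1 : Measurable (s.indicator (1 : E3 → ℝ≥0∞)) := measurable_one.indicator hs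
    have h2 : Measurable fun p : Metric.sphere (0 : E3) 1 × ℝ =>
      s.indicator (1 : E3 → ℝ≥0∞) (p.2 • (p.1 : E3)) := h1.comp hΨ
    rw [← lintegral_indicator_one hs, ← lintegral_indicator_one hs, lintegral_map h1 hΨ, hν,
      lintegral_withDensity_eq_lintegral_mul _ hd h2, lintegral_prod _ (hd.mul h2).aemeasurable,
      lintegral_polar h1]
    rfl
  rw [← hmap, integral_map hΨ.aemeasurable hF.aestronglyMeasurable, hν,
    integral_withDensity_eq_integral_toReal_smul hd (by simp)]
  refine integral_congr_ae (ae_of_all _ fun p => ?_)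
  simp only [ENNReal.toReal_ofReal (sq_nonneg _)]

theorem integral_polar_of_support {V : Type*} [NormedAddCommGroup V] [NormedSpace ℝ V]
    {F : E3 → V} (hF : StronglyMeasurable F) {ρ : ℝ} (hs : ∀ x, ρ ≤ ‖x‖ → F x = 0) :
    ∫ x, F x = ∫ p : Metric.sphere (0 : E3) 1 × ℝ, p.2 ^ 2 • F (p.2 • (p.1 : E3))
      ∂(sigma.prod (volume.restrict (Ioo 0 ρ))) := by
  rw [integral_polar hF, ← Measure.restrict_univ (μ := sigma), Measure.prod_restrict,
    Measure.prod_restrict]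
  refine setIntegral_eq_of_subset_of_forall_sdiff_eq_zero (MeasurableSet.univ.prod measurableSet_Ioi)
    (prod_mono subset_rfl Ioo_subset_Ioi_self) fun p hp => ?_
  have h0 : 0 < p.2 := hp.1.2
  rw [hs, smul_zero]
  rw [norm_smul, norm_coe_sphere, mul_one, Real.norm_of_nonneg h0.le]
  by_contra h
  exact hp.2 ⟨trivial, h0, not_le.1 h⟩

theorem sigma_real_univ : sigma.real univ = 4 * Real.pi := by
  have h := map_inner_sigma (e := EuclideanSpace.single 0 1) (by simp)
  have h1 := congrArg (fun μ : Measure ℝ => μ univ) h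
  rw [Measure.map_apply (Continuous.measurable (by fun_prop)) MeasurableSet.univ, preimage_univ,
    Measure.smul_apply, Measure.restrict_apply_univ, Real.volume_Icc, smul_eq_mul,
    ← ENNReal.ofReal_mul (by positivity)] at h1
  rw [Measure.real, h1, ENNReal.toReal_ofReal (by positivity)]
  ring

/-! ### Moments of ball integrals, computed over the ball -/

/-- The integral of `f` over the ball of squared radius `τ` around `z`, as a radial integral. -/
def ballInt (f : E3 → ℝ) (z : E3) (τ : ℝ) : ℝ := ∫ s in (0 : ℝ)..√τ, s ^ 2 * sMean f z s

theorem integrable_sphere_prod_Ioo {V : Type*} [NormedAddCommGroup V]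
    {F : Metric.sphere (0 : E3) 1 × ℝ → V} (hF : Continuous F) (ρ : ℝ) :
    Integrable F (sigma.prod (volume.restrict (Ioo 0 ρ))) := by
  rw [← Measure.restrict_univ (μ := sigma), Measure.prod_restrict]
  exact (hF.continuousOn.integrableOn_compact (isCompact_univ.prod isCompact_Icc)).mono_set
    (prod_mono subset_rfl Ioo_subset_Icc_self)

theorem ballInt_eq {f : E3 → ℝ} (hf : Continuous f) (z : E3) (τ : ℝ) :
    ballInt f z τ = ∫ x, (Iio τ).indicator 1 (‖x - z‖ ^ 2) * f x := by
  have hm : Measurable ((Iio τ).indicator (1 : ℝ → ℝ)) := measurable_one.indicator measurableSet_Iio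
  rw [← integral_add_left_eq_self _ z]
  simp only [add_sub_cancel_left]
  have h1 : ∫ w : E3, (Iio τ).indicator 1 (‖w‖ ^ 2) * f (z + w) =
      ∫ q : Metric.sphere (0 : E3) 1 × ℝ, q.2 ^ 2 * f (z + q.2 • (q.1 : E3))
        ∂(sigma.prod (volume.restrict (Ioo 0 √τ))) := by
    rw [integral_polar_of_support (ρ := √τ) (Measurable.stronglyMeasurable (by fun_prop)),
      ← Measure.restrict_univ (μ := sigma), Measure.prod_restrict]
    · refine setIntegral_congr_fun (MeasurableSet.univ.prod measurableSet_Ioo) fun q hq => ?_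
      have h0 : 0 < q.2 := hq.2.1
      rw [norm_smul, norm_coe_sphere, mul_one, Real.norm_of_nonneg h0.le,
        indicator_of_mem (mem_Iio.2 ((Real.lt_sqrt h0.le).1 hq.2.2)), Pi.one_apply, one_mul,
        smul_eq_mul]
    · intro x hx
      rw [indicator_of_notMem, zero_mul]
      exact fun h => absurd ((Real.lt_sqrt (norm_nonneg _)).2 h) (not_lt.2 hx)
  rw [h1, integral_prod_symm _ (integrable_sphere_prod_Ioo (by fun_prop) _), ballInt,
    intervalIntegral.integral_of_le (Real.sqrt_nonneg _), integral_Ioc_eq_integral_Ioo]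
  refine integral_congr_ae (ae_of_all _ fun r => ?_)
  simp only [sMean]
  rw [integral_const_mul]

theorem continuous_ballInt {f : E3 → ℝ} (hf : ContDiff ℝ 1 f) :
    Continuous fun p : E3 × ℝ => ballInt f p.1 p.2 := by
  have h := continuous_sMean hf
  have h1 : Continuous (Function.uncurry fun (p : E3 × ℝ) (s : ℝ) => s ^ 2 * sMean f p.1 s) := by
    have : Continuous fun q : (E3 × ℝ) × ℝ => sMean f q.1.1 q.2 :=
      h.comp (continuous_fst.fst.prodMk continuous_snd)
    exact (continuous_snd.pow 2).mul this
  exact intervalIntegral.continuous_parametric_intervalIntegral_of_continuous h1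
    (Real.continuous_sqrt.comp continuous_snd)

/-- The moment over the sphere of radius `R` of the ball integrals of `f`, with the squared radii
`‖y - z‖ ^ 2 + p`. -/
def ballMoment (R : ℝ) (f : E3 → ℝ) (y : E3) (p : ℝ) : E3 :=
  ∫ ω : Metric.sphere (0 : E3) 1,
    ballInt f (R • (ω : E3)) (‖y - R • (ω : E3)‖ ^ 2 + p) • (ω : E3) ∂sigma

/-- The cosine of the angle of the cap of centres `z` whose ball of squared radius
`‖y - z‖ ^ 2 + p` contains `y + w`. -/
def capHeight (R : ℝ) (y : E3) (p : ℝ) (w : E3) : ℝ :=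
  (‖y + w‖ ^ 2 - ‖y‖ ^ 2 - p) / (2 * R * ‖w‖)

/-- Expanding both squares cancels R²|ω|², and the condition on ω becomes linear: 2R⟨w,ω⟩ > |y+w|² -
|y|² - p. -/
theorem integral_cap_of_ne {R : ℝ} (hR : 0 < R) (y : E3) (p : ℝ) {w : E3} (hw : w ≠ 0) :
    ∫ ω : Metric.sphere (0 : E3) 1, (Iio (‖y - R • (ω : E3)‖ ^ 2 + p)).indicator (1 : ℝ → ℝ)
      (‖y + w - R • (ω : E3)‖ ^ 2) • (ω : E3) ∂sigma =
      (Real.pi * max 0 (1 - capHeight R y p w ^ 2) * ‖w‖⁻¹) • w := by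
  have hw' : 0 < ‖w‖ := norm_pos_iff.2 hw
  have he : ‖‖w‖⁻¹ • w‖ = 1 := by
    rw [norm_smul, norm_inv, norm_norm, inv_mul_cancel₀ hw'.ne']
  rw [mul_smul, ← integral_cap he]
  refine integral_congr_ae (ae_of_all _ fun ω => ?_)
  simp only
  congr 1
  have h1 : ‖y + w - R • (ω : E3)‖ ^ 2 < ‖y - R • (ω : E3)‖ ^ 2 + p ↔
      capHeight R y p w < inner ℝ (‖w‖⁻¹ • w) (ω : E3) := by
    rw [capHeight, div_lt_iff₀ (by positivity), inner_smul_left, norm_sub_sq_real, norm_sub_sq_real,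
      inner_add_left, inner_smul_right, inner_smul_right]
    have : (starRingEnd ℝ) ‖w‖⁻¹ * inner ℝ w (ω : E3) * (2 * R * ‖w‖) =
        2 * R * inner ℝ w (ω : E3) := by
      simp only [conj_trivial]
      field_simp
    rw [this]
    constructor <;> intro h <;> linarith
  by_cases h : capHeight R y p w < inner ℝ (‖w‖⁻¹ • w) (ω : E3)
  · rw [indicator_of_mem (mem_Ioi.2 h), indicator_of_mem (mem_Iio.2 (h1.2 h))]
    rfl
  · rw [indicator_of_notMem (fun h' => h (h1.1 (mem_Iio.1 h'))),
      indicator_of_notMem (fun h' => h (mem_Ioi.1 h'))]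

/-- Fubini: the centre is integrated first with the point y + w fixed, which leaves the vector area
of a cap. -/
theorem ballMoment_eq_integral {R : ℝ} (hR : 0 < R) {f : E3 → ℝ} (hf : Continuous f)
    (hc : HasCompactSupport f) (y : E3) (p : ℝ) :
    ballMoment R f y p = ∫ w : E3,
      (f (y + w) * (Real.pi * max 0 (1 - capHeight R y p w ^ 2) * ‖w‖⁻¹)) • w := by
  set χ : Metric.sphere (0 : E3) 1 → E3 → ℝ := fun ω x =>
    (Iio (‖y - R • (ω : E3)‖ ^ 2 + p)).indicator (1 : ℝ → ℝ) (‖x - R • (ω : E3)‖ ^ 2) with hχ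
  have hfi : Integrable f := hf.integrable_of_hasCompactSupport hc
  have h1 : ballMoment R f y p = ∫ ω, (∫ x, (χ ω x * f x) • (ω : E3)) ∂sigma := by
    refine integral_congr_ae (ae_of_all _ fun ω => ?_)
    simp only
    rw [ballInt_eq hf, integral_smul_const]
  have hχ1 : ∀ ω x, |χ ω x| ≤ 1 := fun ω x => by
    simp only [hχ, indicator]
    split_ifs <;> simp
  have hχm : Measurable (Function.uncurry χ) := by
    have : Function.uncurry χ = ({q : Metric.sphere (0 : E3) 1 × E3 |
        ‖q.2 - R • (q.1 : E3)‖ ^ 2 < ‖y - R • (q.1 : E3)‖ ^ 2 + p}).indicator 1 := by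
      ext q
      simp only [Function.uncurry, hχ, indicator, mem_Iio, mem_ofPred_eq, Pi.one_apply]
    rw [this]
    exact measurable_one.indicator (isOpen_lt (by fun_prop) (by fun_prop)).measurableSet
  have hint : Integrable (Function.uncurry fun (ω : Metric.sphere (0 : E3) 1) (x : E3) =>
      (χ ω x * f x) • (ω : E3)) (sigma.prod volume) := by
    have h2 : Integrable (fun q : Metric.sphere (0 : E3) 1 × E3 => ‖f q.2‖) (sigma.prod volume) :=
      hfi.norm.comp_snd sigma
    refine h2.mono' (Measurable.aestronglyMeasurable ?_) (ae_of_all _ fun q => ?_)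
    · exact Measurable.smul (hχm.mul (hf.measurable.comp measurable_snd))
        (measurable_subtype_coe.comp measurable_fst)
    · simp only [Function.uncurry]
      rw [norm_smul, norm_coe_sphere, mul_one, norm_mul]
      exact mul_le_of_le_one_left (norm_nonneg _) (hχ1 _ _)
  rw [h1, integral_integral_swap hint, ← integral_add_left_eq_self _ y]
  refine integral_congr_ae ?_
  have h0 : ∀ᵐ w : E3, w ≠ 0 := by
    have : volume ({0} : Set E3) = 0 := measure_singleton _
    exact compl_mem_ae_iff.2 this
  filter_upwards [h0] with w hw
  rw [mul_smul, ← integral_cap_of_ne hR y p hw, ← integral_smul]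
  refine integral_congr_ae (ae_of_all _ fun ω => ?_)
  simp only [hχ]
  rw [smul_smul, mul_comm]

theorem ballMoment_eq_polar {R : ℝ} (hR : 0 < R) {f : E3 → ℝ} (hf : Continuous f)
    (hsupp : Function.support f ⊆ Metric.closedBall (0 : E3) R) {y : E3} (hy : ‖y‖ < R) (p : ℝ) :
    ballMoment R f y p = ∫ q : Metric.sphere (0 : E3) 1 × ℝ,
      (Real.pi * f (y + q.2 • (q.1 : E3)) *
        (q.2 ^ 2 * max 0 (1 - capHeight R y p (q.2 • (q.1 : E3)) ^ 2))) • (q.1 : E3)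
      ∂(sigma.prod (volume.restrict (Ioo 0 (2 * R)))) := by
  rw [ballMoment_eq_integral hR hf
    (HasCompactSupport.of_support_subset_isCompact (isCompact_closedBall _ _) hsupp),
    integral_polar_of_support (ρ := 2 * R)]
  · rw [← Measure.restrict_univ (μ := sigma), Measure.prod_restrict]
    refine setIntegral_congr_fun (MeasurableSet.univ.prod measurableSet_Ioo) fun q hq => ?_
    have h0 : 0 < q.2 := hq.2.1
    rw [smul_smul, smul_smul]
    congr 1
    rw [norm_smul, norm_coe_sphere, mul_one, Real.norm_of_nonneg h0.le]
    field_simp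
  · unfold capHeight
    exact Measurable.stronglyMeasurable (by fun_prop)
  · intro w hw
    rw [eq_zero_of_le_norm hR hf hsupp, zero_mul, zero_smul]
    have := norm_sub_norm_le w (-y)
    rw [norm_neg, sub_neg_eq_add, add_comm w] at this
    linarith

theorem smul_integral_second_difference {α V : Type*} [MeasurableSpace α] {μ : Measure α}
    [NormedAddCommGroup V] [NormedSpace ℝ V] {A B C : α → V} (hA : Integrable A μ)
    (hB : Integrable B μ) (hC : Integrable C μ) (c : ℝ) :
    c • (∫ x, A x ∂μ + ∫ x, B x ∂μ - (2 : ℝ) • ∫ x, C x ∂μ) =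
      ∫ x, c • (A x + B x - (2 : ℝ) • C x) ∂μ := by
  have h1 := integral_sub (hA.add hB) (hC.smul (2 : ℝ))
  simp only [Pi.add_apply, Pi.smul_apply] at h1
  rw [integral_smul, h1, integral_add hA hB, integral_smul]

theorem hat_second_difference_eq {h δ η : ℝ} (hh : |h| ≤ 1 - η) (hδ : |δ| ≤ η) :
    max 0 (1 - (h - δ) ^ 2) + max 0 (1 - (h + δ) ^ 2) - 2 * max 0 (1 - h ^ 2) = -2 * δ ^ 2 := by
  have hm : ∀ u : ℝ, |u| ≤ 1 → max 0 (1 - u ^ 2) = 1 - u ^ 2 := fun u hu => by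
    refine max_eq_right ?_
    have := (sq_le_one_iff_abs_le_one u).2 hu
    linarith
  have h0 := abs_nonneg δ
  rw [hm _ ((abs_sub _ _).trans (by linarith)), hm _ ((abs_add_le _ _).trans (by linarith)),
    hm _ (by linarith)]
  ring

/-- In the application δ = p/(2Rr) is unbounded as r → 0, so a bound for all δ is needed. For |δ| >
η the values of the hat function in [0, 1] bound the left side by 2, and 2 ≤ 2δ²/η². -/
theorem abs_hat_second_difference_le {h δ η : ℝ} (hη : 0 < η) (hη1 : η ≤ 1) (hh : |h| ≤ 1 - η) :
    |max 0 (1 - (h - δ) ^ 2) + max 0 (1 - (h + δ) ^ 2) - 2 * max 0 (1 - h ^ 2)| ≤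
      2 * δ ^ 2 / η ^ 2 := by
  rcases le_or_gt |δ| η with hδ | hδ
  · rw [hat_second_difference_eq hh hδ, abs_mul, abs_neg, abs_two, abs_of_nonneg (sq_nonneg δ),
      le_div_iff₀ (by positivity)]
    exact mul_le_of_le_one_right (by positivity) (pow_le_one₀ hη.le hη1)
  · have h1 : 2 ≤ 2 * δ ^ 2 / η ^ 2 := by
      rw [le_div_iff₀ (by positivity), ← sq_abs δ]
      nlinarith
    refine le_trans ?_ h1
    have hm : ∀ u : ℝ, 0 ≤ max 0 (1 - u ^ 2) ∧ max 0 (1 - u ^ 2) ≤ 1 := fun u =>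
      ⟨le_max_left _ _, max_le zero_le_one (by nlinarith [sq_nonneg u])⟩
    have a := hm (h - δ)
    have b := hm (h + δ)
    have c := hm h
    rw [abs_le]
    constructor <;> linarith [a.1, a.2, b.1, b.2, c.1, c.2]

/-- The field `∫∫ f (y + r θ) θ dr dθ`. -/
def radialField (R : ℝ) (f : E3 → ℝ) (y : E3) : E3 :=
  ∫ q : Metric.sphere (0 : E3) 1 × ℝ, f (y + q.2 • (q.1 : E3)) • (q.1 : E3)
    ∂(sigma.prod (volume.restrict (Ioo 0 (2 * R))))

theorem ae_prod_Ioo (ρ : ℝ) :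
    ∀ᵐ q : Metric.sphere (0 : E3) 1 × ℝ ∂(sigma.prod (volume.restrict (Ioo 0 ρ))),
      q.2 ∈ Ioo 0 ρ :=
  Measure.quasiMeasurePreserving_snd.ae (ae_restrict_mem measurableSet_Ioo)

/-- Factor |y+w|² - |y|² as a difference times a sum, bounded by |w| and R + |y|. For y in the open
ball this keeps the heights uniformly away from the kinks ±1 of the hat function. -/
theorem abs_capHeight_zero_le {R : ℝ} (hR : 0 < R) {y w : E3} (hw : w ≠ 0)
    (hyw : ‖y + w‖ ≤ R) : |capHeight R y 0 w| ≤ 1 - (R - ‖y‖) / (2 * R) := by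
  have hw' : 0 < ‖w‖ := norm_pos_iff.2 hw
  have h1 : |‖y + w‖ - ‖y‖| ≤ ‖w‖ := by simpa using abs_norm_sub_norm_le (y + w) y
  rw [capHeight, sub_zero, abs_div, abs_of_pos (by positivity : 0 < 2 * R * ‖w‖),
    div_le_iff₀ (by positivity), show ‖y + w‖ ^ 2 - ‖y‖ ^ 2 =
      (‖y + w‖ - ‖y‖) * (‖y + w‖ + ‖y‖) by ring, abs_mul,
    abs_of_nonneg (by positivity : 0 ≤ ‖y + w‖ + ‖y‖),
    show (1 - (R - ‖y‖) / (2 * R)) * (2 * R * ‖w‖) = ‖w‖ * (R + ‖y‖) by field_simp; ring]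
  gcongr

theorem capHeight_eq {R : ℝ} (y : E3) (p : ℝ) (w : E3) :
    capHeight R y p w = capHeight R y 0 w - p / (2 * R * ‖w‖) := by
  rw [capHeight, capHeight, sub_zero, sub_div]

/-- On the support of f, for fixed r and small p, the integrand no longer depends on p: the second
difference of 1 - h² is exactly -2(p/(2Rr))², and r² cancels the denominator. The uniform bound
gives dominated convergence near r = 0. -/
theorem tendsto_ballMoment_radialField {R : ℝ} (hR : 0 < R) {f : E3 → ℝ} (hf : Continuous f)
    (hsupp : Function.support f ⊆ Metric.closedBall (0 : E3) R) {y : E3} (hy : ‖y‖ < R) :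
    Tendsto (fun p : ℝ => (p ^ 2)⁻¹ •
      (ballMoment R f y p + ballMoment R f y (-p) - (2 : ℝ) • ballMoment R f y 0)) (𝓝[>] 0)
      (𝓝 ((-(Real.pi / (2 * R ^ 2))) • radialField R f y)) := by
  set μ := sigma.prod (volume.restrict (Ioo (0 : ℝ) (2 * R))) with hμ
  set m : ℝ → Metric.sphere (0 : E3) 1 × ℝ → ℝ := fun p q =>
    max 0 (1 - capHeight R y p (q.2 • (q.1 : E3)) ^ 2) with hm
  have hmm : ∀ p, Measurable (m p) := fun p => by
    have h1 : Continuous fun q : Metric.sphere (0 : E3) 1 × ℝ => ‖q.2 • (q.1 : E3)‖ := by fun_prop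
    have h2 : Continuous fun q : Metric.sphere (0 : E3) 1 × ℝ => ‖y + q.2 • (q.1 : E3)‖ := by
      fun_prop
    have h1' := h1.measurable
    have h2' := h2.measurable
    simp only [hm, capHeight]
    fun_prop
  have hm1 : ∀ p q, ‖m p q‖ ≤ 1 := fun p q => by
    rw [Real.norm_of_nonneg (le_max_left _ _)]
    exact max_le zero_le_one (by nlinarith [sq_nonneg (capHeight R y p (q.2 • (q.1 : E3)))])
  have hint : ∀ p, Integrable (fun q : Metric.sphere (0 : E3) 1 × ℝ =>
      (Real.pi * f (y + q.2 • (q.1 : E3)) * (q.2 ^ 2 * m p q)) • (q.1 : E3)) μ := fun p => by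
    have h1 : Integrable (fun q : Metric.sphere (0 : E3) 1 × ℝ =>
      (Real.pi * f (y + q.2 • (q.1 : E3)) * q.2 ^ 2) • (q.1 : E3)) μ :=
        integrable_sphere_prod_Ioo (by fun_prop) _
    refine (h1.bdd_smul 1 (hmm p).aestronglyMeasurable (ae_of_all _ (hm1 p))).congr
      (ae_of_all _ fun q => ?_)
    simp only [Pi.smul_apply', smul_smul]
    congr 1
    ring
  have hB : ∀ p, ballMoment R f y p = ∫ q, (Real.pi * f (y + q.2 • (q.1 : E3)) *
      (q.2 ^ 2 * m p q)) • (q.1 : E3) ∂μ := fun p => ballMoment_eq_polar hR hf hsupp hy p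
  have hsd : ∀ p, (p ^ 2)⁻¹ •
      (ballMoment R f y p + ballMoment R f y (-p) - (2 : ℝ) • ballMoment R f y 0) =
      ∫ q, (Real.pi * f (y + q.2 • (q.1 : E3)) * (q.2 ^ 2 *
        ((m p q + m (-p) q - 2 * m 0 q) / p ^ 2))) • (q.1 : E3) ∂μ := fun p => by
    rw [hB, hB, hB, smul_integral_second_difference (hint _) (hint _) (hint _)]
    refine integral_congr_ae (ae_of_all _ fun q => ?_)
    simp only [smul_smul, ← add_smul, ← sub_smul]
    congr 1
    ring
  have hlim : (-(Real.pi / (2 * R ^ 2))) • radialField R f y = ∫ q,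
      (Real.pi * f (y + q.2 • (q.1 : E3)) * (-(1 / (2 * R ^ 2)))) • (q.1 : E3) ∂μ := by
    rw [radialField, ← integral_smul]
    refine integral_congr_ae (ae_of_all _ fun q => ?_)
    simp only [smul_smul]
    congr 1
    ring
  set η := (R - ‖y‖) / (2 * R) with hη
  have hη0 : 0 < η := div_pos (by linarith) (by positivity)
  have hη1 : η ≤ 1 := by
    rw [hη, div_le_one (by positivity)]
    linarith [norm_nonneg y]
  have hcap : ∀ (p : ℝ) (q : Metric.sphere (0 : E3) 1 × ℝ), 0 < q.2 →
      m p q + m (-p) q - 2 * m 0 q =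
      max 0 (1 - (capHeight R y 0 (q.2 • (q.1 : E3)) - p / (2 * R * q.2)) ^ 2) +
      max 0 (1 - (capHeight R y 0 (q.2 • (q.1 : E3)) + p / (2 * R * q.2)) ^ 2) -
      2 * max 0 (1 - capHeight R y 0 (q.2 • (q.1 : E3)) ^ 2) := fun p q hq => by
    simp only [hm]
    rw [capHeight_eq y p, capHeight_eq y (-p), norm_smul, norm_coe_sphere, mul_one,
      Real.norm_of_nonneg hq.le, neg_div, sub_neg_eq_add]
  have hcap0 : ∀ q : Metric.sphere (0 : E3) 1 × ℝ, 0 < q.2 → f (y + q.2 • (q.1 : E3)) ≠ 0 →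
      |capHeight R y 0 (q.2 • (q.1 : E3))| ≤ 1 - η := fun q hq hfq => by
    refine abs_capHeight_zero_le hR ?_ ?_
    · rw [← norm_pos_iff, norm_smul, norm_coe_sphere, mul_one, Real.norm_of_nonneg hq.le]
      exact hq
    · simpa using hsupp hfq
  simp_rw [hsd]
  rw [hlim]
  have hfi : Integrable (fun q : Metric.sphere (0 : E3) 1 × ℝ =>
      |Real.pi * f (y + q.2 • (q.1 : E3))| * (1 / (2 * R ^ 2 * η ^ 2))) μ :=
    integrable_sphere_prod_Ioo (by fun_prop) _
  refine tendsto_integral_filter_of_dominated_convergence _ ?_ ?_ hfi ?_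
  · refine Eventually.of_forall fun p => ?_
    have h1 : Continuous fun q : Metric.sphere (0 : E3) 1 × ℝ =>
      Real.pi * f (y + q.2 • (q.1 : E3)) := by fun_prop
    have h2 := h1.measurable
    have h3 := hmm p
    have h4 := hmm (-p)
    have h5 := hmm 0
    exact Measurable.aestronglyMeasurable (by fun_prop)
  · filter_upwards [self_mem_nhdsWithin] with p hp
    have hp : 0 < p := hp
    filter_upwards [ae_prod_Ioo (2 * R)] with q hq
    have hq0 : 0 < q.2 := hq.1
    rw [norm_smul, norm_coe_sphere, mul_one, norm_mul, Real.norm_eq_abs, Real.norm_eq_abs]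
    rcases eq_or_ne (f (y + q.2 • (q.1 : E3))) 0 with h0 | h0
    · simp [h0]
    gcongr
    rw [hcap p q hq0, abs_mul, abs_div, abs_of_nonneg (sq_nonneg q.2), abs_of_nonneg (sq_nonneg p)]
    have := abs_hat_second_difference_le (δ := p / (2 * R * q.2)) hη0 hη1 (hcap0 q hq0 h0)
    refine (mul_le_mul_of_nonneg_left (div_le_div_of_nonneg_right this (sq_nonneg p))
      (sq_nonneg q.2)).trans (le_of_eq ?_)
    field_simp
  · filter_upwards [ae_prod_Ioo (2 * R)] with q hq
    have hq0 : 0 < q.2 := hq.1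
    rcases eq_or_ne (f (y + q.2 • (q.1 : E3))) 0 with h0 | h0
    · simp [h0]
    refine tendsto_const_nhds.congr' ?_
    have h1 : ∀ᶠ p : ℝ in 𝓝[>] 0, p < η * (2 * R * q.2) :=
      nhdsWithin_le_nhds (gt_mem_nhds (by positivity))
    filter_upwards [self_mem_nhdsWithin, h1] with p hp hp1
    have hp : 0 < p := hp
    rw [hcap p q hq0, hat_second_difference_eq (η := η) (hcap0 q hq0 h0)]
    · congr 2
      field_simp
    · rw [abs_of_pos (by positivity), div_le_iff₀ (by positivity)]
      exact hp1.le

/-! ### Second difference quotients -/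

/-- The limit of symmetric second difference quotients. -/
theorem tendsto_second_difference {q q' : ℝ → ℝ} {τ δ c : ℝ} (hδ : 0 < δ)
    (hq : ∀ s, |s - τ| < δ → HasDerivAt q (q' s) s) (hq' : HasDerivAt q' c τ) :
    Tendsto (fun p : ℝ => (p ^ 2)⁻¹ * (q (τ + p) + q (τ - p) - 2 * q τ)) (𝓝[>] 0) (𝓝 c) := by
  have hd : ∀ p, |p| < δ → HasDerivAt (fun p => q (τ + p) + q (τ - p) - 2 * q τ)
      (q' (τ + p) - q' (τ - p)) p := fun p hp => by
    have h1 := (hq (τ + p) (by simpa using hp)).comp p ((hasDerivAt_id p).const_add τ)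
    have h2 := (hq (τ - p) (by simpa using hp)).comp p ((hasDerivAt_id p).const_sub τ)
    exact ((h1.add h2).sub_const (2 * q τ)).congr_deriv (by ring)
  have hev : ∀ᶠ p : ℝ in 𝓝[>] 0, |p| < δ := by
    filter_upwards [self_mem_nhdsWithin, nhdsWithin_le_nhds (gt_mem_nhds hδ)] with p hp hp1
    rwa [abs_of_pos hp]
  have hslope : Tendsto (fun p : ℝ => (q' (τ + p) - q' (τ - p)) / (2 * p)) (𝓝[>] 0) (𝓝 c) := by
    have h1 : HasDerivAt (fun p => q' (τ + p) - q' (τ - p)) (2 * c) 0 := by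
      have a : HasDerivAt q' c (τ + 0) := by simpa using hq'
      have b : HasDerivAt q' c (τ - 0) := by simpa using hq'
      have a1 := a.comp 0 ((hasDerivAt_id (0 : ℝ)).const_add τ)
      have b1 := b.comp 0 ((hasDerivAt_id (0 : ℝ)).const_sub τ)
      exact (a1.sub b1).congr_deriv (by ring)
    have h2 := (hasDerivAt_iff_tendsto_slope_zero.1 h1).mono_left
      (nhdsWithin_mono 0 (fun p (hp : 0 < p) => hp.ne'))
    have h3 := h2.const_mul (1 / 2)
    rw [show 1 / 2 * (2 * c) = c by ring] at h3
    refine h3.congr fun p => ?_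
    simp only [zero_add, add_zero, sub_zero, sub_self, smul_eq_mul]
    field_simp
  -- One application of L'Hôpital leads to the symmetric slope of q', so q' need only be
  -- differentiable at τ itself.
  have := HasDerivAt.lhopital_zero_nhdsGT (g := fun p : ℝ => p ^ 2) (g' := fun p => 2 * p)
    (hev.mono hd) (Eventually.of_forall fun p => by simpa using hasDerivAt_pow 2 p)
    (by filter_upwards [self_mem_nhdsWithin] with p hp using (mul_pos two_pos hp).ne')
    ?_ ?_ hslope
  · refine this.congr fun p => ?_
    rw [div_eq_inv_mul]
  · have h1 := (hd 0 (by simpa using hδ)).continuousAt.tendsto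
    have h2 : q (τ + 0) + q (τ - 0) - 2 * q τ = 0 := by simp only [add_zero, sub_zero]; ring
    rw [h2] at h1
    exact h1.mono_left nhdsWithin_le_nhds
  · have h1 : Tendsto (fun p : ℝ => p ^ 2) (𝓝 0) (𝓝 (0 ^ 2)) := (continuous_pow 2).tendsto 0
    rw [zero_pow two_ne_zero] at h1
    exact h1.mono_left nhdsWithin_le_nhds

/-- The mean value inequality for q', then for the second difference as a function of p. The
constant 2 is not sharp but suffices as a dominating bound. -/
theorem abs_second_difference_le {q q' q'' : ℝ → ℝ} {τ δ L : ℝ}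
    (hq : ∀ s, |s - τ| < δ → HasDerivAt q (q' s) s)
    (hq' : ∀ s, |s - τ| < δ → HasDerivAt q' (q'' s) s) (hL : ∀ s, |s - τ| < δ → |q'' s| ≤ L)
    {p : ℝ} (hp : 0 < p) (hpδ : p < δ) :
    |q (τ + p) + q (τ - p) - 2 * q τ| ≤ 2 * L * p ^ 2 := by
  have hd : ∀ s ∈ Icc 0 p, HasDerivWithinAt (fun p => q (τ + p) + q (τ - p))
      (q' (τ + s) - q' (τ - s)) (Icc 0 p) s := fun s hs => by
    have hs' : |s| < δ := by rw [abs_of_nonneg hs.1]; exact hs.2.trans_lt hpδ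
    have h1 := (hq (τ + s) (by simpa using hs')).comp s ((hasDerivAt_id s).const_add τ)
    have h2 := (hq (τ - s) (by simpa using hs')).comp s ((hasDerivAt_id s).const_sub τ)
    exact ((h1.add h2).congr_deriv (by ring)).hasDerivWithinAt
  have hb : ∀ s ∈ Icc 0 p, ‖q' (τ + s) - q' (τ - s)‖ ≤ 2 * L * p := fun s hs => by
    have h1 := Convex.norm_image_sub_le_of_norm_hasDerivWithin_le (f := q') (f' := q'')
      (s := Metric.ball τ δ) (C := L) (x := τ - s) (y := τ + s)
      (fun x hx => (hq' x (by simpa [Real.dist_eq] using hx)).hasDerivWithinAt)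
      (fun x hx => hL x (by simpa [Real.dist_eq] using hx)) (convex_ball τ δ)
      (by simpa [abs_of_nonneg hs.1] using hs.2.trans_lt hpδ)
      (by simpa [abs_of_nonneg hs.1] using hs.2.trans_lt hpδ)
    have hL0 : 0 ≤ L := (abs_nonneg _).trans (hL τ (by simpa using hp.trans hpδ))
    refine h1.trans ?_
    rw [show τ + s - (τ - s) = 2 * s by ring, Real.norm_of_nonneg (by linarith [hs.1])]
    nlinarith [mul_le_mul_of_nonneg_left hs.2 hL0]
  have := Convex.norm_image_sub_le_of_norm_hasDerivWithin_le hd hb (convex_Icc 0 p)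
    (left_mem_Icc.2 hp.le) (right_mem_Icc.2 hp.le)
  simp only [add_zero, sub_zero] at this
  rw [Real.norm_of_nonneg hp.le, Real.norm_eq_abs, ← two_mul] at this
  exact this.trans (le_of_eq (by ring))

/-! ### The same moments, computed over the sphere of centres -/

section SphereSide

variable {f : E3 → ℝ} (hf : ContDiff ℝ 1 f) (hc : HasCompactSupport f)
include hf

theorem hasDerivAt_ballInt (z : E3) {τ : ℝ} (hτ : 0 < τ) :
    HasDerivAt (ballInt f z) (√τ * sMean f z √τ / 2) τ := by
  have hcont : Continuous fun s => s ^ 2 * sMean f z s :=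
    (continuous_pow 2).mul ((continuous_sMean hf).comp (Continuous.prodMk_right z))
  have h1 := (hcont.integral_hasStrictDerivAt 0 √τ).hasDerivAt.comp τ
    (Real.hasDerivAt_sqrt hτ.ne')
  refine h1.congr_deriv ?_
  have := Real.sqrt_pos.2 hτ
  field_simp

include hc

theorem hasDerivAt_deriv_ballInt (z : E3) {τ : ℝ} (hτ : 0 < τ) :
    HasDerivAt (fun τ => √τ * sMean f z √τ / 2)
      ((sMean f z √τ + √τ * sMeanD f z √τ) / (4 * √τ)) τ := by
  have h1 := ((hasDerivAt_mul_sMean hf hc z √τ).comp τ (Real.hasDerivAt_sqrt hτ.ne')).div_const 2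
  refine h1.congr_deriv ?_
  have := Real.sqrt_pos.2 hτ
  field_simp
  ring

theorem tendsto_ballMoment_sphere {R : ℝ} {y : E3} (hy : ‖y‖ < R) :
    Tendsto (fun p : ℝ => (p ^ 2)⁻¹ •
      (ballMoment R f y p + ballMoment R f y (-p) - (2 : ℝ) • ballMoment R f y 0)) (𝓝[>] 0)
      (𝓝 (∫ ω : Metric.sphere (0 : E3) 1, ((sMean f (R • (ω : E3)) ‖y - R • (ω : E3)‖ +
        ‖y - R • (ω : E3)‖ * sMeanD f (R • (ω : E3)) ‖y - R • (ω : E3)‖) /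
        (4 * ‖y - R • (ω : E3)‖)) • (ω : E3) ∂sigma)) := by
  have hR : 0 < R := (norm_nonneg y).trans_lt hy
  obtain ⟨C₁, hC₁, hM⟩ := exists_bound_sMean hf hc
  obtain ⟨C₂, hC₂, hD⟩ := exists_bound_sMeanD hf hc
  set d := R - ‖y‖ with hd
  have hd0 : 0 < d := by linarith
  have hdist : ∀ ω : Metric.sphere (0 : E3) 1, d ≤ ‖y - R • (ω : E3)‖ := fun ω => by
    have := norm_sub_norm_le (R • (ω : E3)) y
    rw [norm_smul, norm_coe_sphere, mul_one, Real.norm_of_nonneg hR.le, norm_sub_rev] at this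
    exact this
  -- Squared distances from y to the boundary are at least d², so a δ-neighbourhood of each stays
  -- above δ, away from the singularity of the square root at 0.
  set δ := d ^ 2 / 2 with hδ
  have hδ0 : 0 < δ := by positivity
  have hτ : ∀ (ω : Metric.sphere (0 : E3) 1) (s : ℝ), |s - ‖y - R • (ω : E3)‖ ^ 2| < δ → δ < s :=
    fun ω s hs => by
      have h1 := (abs_lt.1 hs).1
      have h2 := pow_le_pow_left₀ hd0.le (hdist ω) 2
      linarith
  set L := (C₁ / √δ + C₂) / 4 with hL
  have hsδ : 0 < √δ := Real.sqrt_pos.2 hδ0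
  have hbound : ∀ (z : E3) (s : ℝ), δ < s →
      |(sMean f z √s + √s * sMeanD f z √s) / (4 * √s)| ≤ L := fun z s hs => by
    have h1 : √δ ≤ √s := Real.sqrt_le_sqrt hs.le
    have h2 : 0 < √s := hsδ.trans_le h1
    rw [show (sMean f z √s + √s * sMeanD f z √s) / (4 * √s) =
      (sMean f z √s / √s + sMeanD f z √s) / 4 by field_simp, abs_div _ (4 : ℝ),
      abs_of_pos (four_pos (α := ℝ)), hL]
    gcongr
    refine (abs_add_le _ _).trans ?_
    rw [abs_div, abs_of_pos h2]
    gcongr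
    · exact hM _ _
    · exact hD _ _
  have hcont : ∀ p, Continuous fun ω : Metric.sphere (0 : E3) 1 =>
      ballInt f (R • (ω : E3)) (‖y - R • (ω : E3)‖ ^ 2 + p) := fun p =>
    (continuous_ballInt hf).comp (Continuous.prodMk (by fun_prop) (by fun_prop))
  have hint : ∀ p, Integrable (fun ω : Metric.sphere (0 : E3) 1 =>
      ballInt f (R • (ω : E3)) (‖y - R • (ω : E3)‖ ^ 2 + p) • (ω : E3)) sigma := fun p =>
    integrable_sphere ((hcont p).smul continuous_subtype_val)
  have hsd : ∀ p, (p ^ 2)⁻¹ •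
      (ballMoment R f y p + ballMoment R f y (-p) - (2 : ℝ) • ballMoment R f y 0) =
      ∫ ω : Metric.sphere (0 : E3) 1, ((p ^ 2)⁻¹ *
        (ballInt f (R • (ω : E3)) (‖y - R • (ω : E3)‖ ^ 2 + p) +
        ballInt f (R • (ω : E3)) (‖y - R • (ω : E3)‖ ^ 2 - p) -
        2 * ballInt f (R • (ω : E3)) (‖y - R • (ω : E3)‖ ^ 2))) • (ω : E3) ∂sigma := fun p => by
    rw [ballMoment, ballMoment, ballMoment, smul_integral_second_difference (hint _) (hint _) (hint _)]
    refine integral_congr_ae (ae_of_all _ fun q => ?_)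
    simp only [smul_smul, ← add_smul, ← sub_smul, add_zero, ← sub_eq_add_neg]
  simp_rw [hsd]
  have hq : ∀ (ω : Metric.sphere (0 : E3) 1) (s : ℝ), |s - ‖y - R • (ω : E3)‖ ^ 2| < δ → _ :=
    fun ω s hs => hasDerivAt_ballInt hf (R • (ω : E3)) (hδ0.trans (hτ ω s hs))
  have hq' : ∀ (ω : Metric.sphere (0 : E3) 1) (s : ℝ), |s - ‖y - R • (ω : E3)‖ ^ 2| < δ → _ :=
    fun ω s hs => hasDerivAt_deriv_ballInt hf hc (R • (ω : E3)) (hδ0.trans (hτ ω s hs))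
  refine tendsto_integral_filter_of_dominated_convergence (fun _ => 2 * L) ?_ ?_
    (integrable_const _) ?_
  · refine Eventually.of_forall fun p => Continuous.aestronglyMeasurable ?_
    have h1 := hcont p
    have h2 := hcont (-p)
    have h3 := hcont 0
    simp only [← sub_eq_add_neg, add_zero] at h2 h3
    fun_prop
  · filter_upwards [self_mem_nhdsWithin, nhdsWithin_le_nhds (gt_mem_nhds hδ0)] with p hp hpδ
    have hp : 0 < p := hp
    refine ae_of_all _ fun ω => ?_
    have h1 := abs_second_difference_le (hq ω) (hq' ω) (fun s hs => hbound _ s (hτ ω s hs)) hp hpδ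
    rw [norm_smul, norm_coe_sphere, mul_one, norm_mul, Real.norm_of_nonneg (by positivity),
      Real.norm_eq_abs, inv_mul_le_iff₀ (by positivity)]
    exact h1.trans (le_of_eq (by ring))
  · refine ae_of_all _ fun ω => Tendsto.smul_const ?_ _
    have h1 := tendsto_second_difference hδ0 (hq ω) (hq' ω _ (by simpa using hδ0))
    rwa [Real.sqrt_sq (norm_nonneg _)] at h1

/-- The sphere integral of the inversion formula as a field of `f`. -/
theorem integral_sphere_eq_radialField {R : ℝ}
    (hsupp : Function.support f ⊆ Metric.closedBall (0 : E3) R) {y : E3} (hy : ‖y‖ < R) :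
    ∫ ω : Metric.sphere (0 : E3) 1, ((sMean f (R • (ω : E3)) ‖y - R • (ω : E3)‖ +
        ‖y - R • (ω : E3)‖ * sMeanD f (R • (ω : E3)) ‖y - R • (ω : E3)‖) /
        (4 * ‖y - R • (ω : E3)‖)) • (ω : E3) ∂sigma =
      (-(Real.pi / (2 * R ^ 2))) • radialField R f y :=
  tendsto_nhds_unique (tendsto_ballMoment_sphere hf hc hy) (tendsto_ballMoment_radialField
    ((norm_nonneg y).trans_lt hy) hf.continuous hsupp hy)

end SphereSide

/-! ### Divergence of the radial field -/

section Divergence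

variable {f : E3 → ℝ} (hf : ContDiff ℝ 1 f) (hc : HasCompactSupport f)
include hf hc

theorem hasFDerivAt_radialField (R : ℝ) (y : E3) :
    HasFDerivAt (radialField R f) (∫ q : Metric.sphere (0 : E3) 1 × ℝ,
      (fderiv ℝ f (y + q.2 • (q.1 : E3))).smulRight (q.1 : E3)
      ∂(sigma.prod (volume.restrict (Ioo 0 (2 * R))))) y := by
  have h1 := hf.continuous
  have h2 := hf.continuous_fderiv one_ne_zero
  obtain ⟨C, hC0, hC⟩ := exists_bound_of_hasCompactSupport h2 (hc.fderiv ℝ)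
  have hF' : ∀ x : E3, Continuous fun q : Metric.sphere (0 : E3) 1 × ℝ =>
      (fderiv ℝ f (x + q.2 • (q.1 : E3))).smulRight (q.1 : E3) := fun x => by fun_prop
  have hF : ∀ x : E3, Continuous fun q : Metric.sphere (0 : E3) 1 × ℝ =>
      f (x + q.2 • (q.1 : E3)) • (q.1 : E3) := fun x => by fun_prop
  refine hasFDerivAt_integral_of_dominated_of_fderiv_le (bound := fun _ => C)
    (μ := sigma.prod (volume.restrict (Ioo 0 (2 * R))))
    (F := fun x q => f (x + q.2 • (q.1 : E3)) • (q.1 : E3))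
    (F' := fun x q => (fderiv ℝ f (x + q.2 • (q.1 : E3))).smulRight (q.1 : E3)) univ_mem
    (Eventually.of_forall fun x => (hF x).aestronglyMeasurable)
    (integrable_sphere_prod_Ioo (hF y) _) (hF' y).aestronglyMeasurable
    (ae_of_all _ fun q x _ => ?_) (integrable_const C) (ae_of_all _ fun q x _ => ?_)
  · rw [ContinuousLinearMap.norm_smulRight_apply, norm_coe_sphere, mul_one]
    exact hC _
  · have h3 : HasFDerivAt (fun x : E3 => f (x + q.2 • (q.1 : E3)))
        (fderiv ℝ f (x + q.2 • (q.1 : E3))) x := by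
      have := (hf.differentiable one_ne_zero (x + q.2 • (q.1 : E3))).hasFDerivAt
      exact (this.comp x ((hasFDerivAt_id x).add_const (q.2 • (q.1 : E3)))).congr_fderiv
        (ContinuousLinearMap.comp_id _)
    exact h3.smul_const (q.1 : E3)

/-- The trace of the differentiated integrand is the derivative of f along the ray. Its integral
over r is -f(y), since y + 2Rθ lies outside B, and the sphere has area 4π. -/
theorem divergence_radialField {R : ℝ} (hR : 0 < R)
    (hsupp : Function.support f ⊆ Metric.closedBall (0 : E3) R) {y : E3} (hy : ‖y‖ < R) :
    divergence (radialField R f) y = -(4 * Real.pi) * f y := by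
  have h2 := hf.continuous_fderiv one_ne_zero
  have hF' : Integrable (fun q : Metric.sphere (0 : E3) 1 × ℝ =>
      (fderiv ℝ f (y + q.2 • (q.1 : E3))).smulRight (q.1 : E3))
      (sigma.prod (volume.restrict (Ioo 0 (2 * R)))) :=
    integrable_sphere_prod_Ioo (by fun_prop) _
  have h3 : ∀ i : Fin 3, ((∫ q : Metric.sphere (0 : E3) 1 × ℝ,
      (fderiv ℝ f (y + q.2 • (q.1 : E3))).smulRight (q.1 : E3)
      ∂(sigma.prod (volume.restrict (Ioo 0 (2 * R))))) (EuclideanSpace.single i 1)) i =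
      ∫ q : Metric.sphere (0 : E3) 1 × ℝ, (q.1 : E3) i *
        fderiv ℝ f (y + q.2 • (q.1 : E3)) (EuclideanSpace.single i 1)
        ∂(sigma.prod (volume.restrict (Ioo 0 (2 * R)))) := fun i => by
    have h4 := ((EuclideanSpace.proj i : E3 →L[ℝ] ℝ).comp
      (ContinuousLinearMap.apply ℝ E3 (EuclideanSpace.single i 1 : E3))).integral_comp_comm hF'
    refine Eq.trans (Eq.symm h4) ?_
    refine integral_congr_ae (ae_of_all _ fun q => ?_)
    simp [mul_comm]
  have h5 : ∀ (x θ : E3), ∑ i : Fin 3, θ i * fderiv ℝ f x (EuclideanSpace.single i 1) =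
      fderiv ℝ f x θ := fun x θ => by
    conv_rhs => rw [← (EuclideanSpace.basisFun (Fin 3) ℝ).sum_repr θ]
    simp
  rw [divergence, (hasFDerivAt_radialField hf hc R y).fderiv]
  simp_rw [h3]
  rw [← integral_finsetSum _ fun i _ => integrable_sphere_prod_Ioo (by fun_prop) _]
  simp_rw [h5]
  rw [integral_prod _ (integrable_sphere_prod_Ioo (by fun_prop) _)]
  have h6 : ∀ θ : Metric.sphere (0 : E3) 1,
      ∫ r in Ioo 0 (2 * R), fderiv ℝ f (y + r • (θ : E3)) (θ : E3) = -f y := fun θ => by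
    rw [← integral_Ioc_eq_integral_Ioo, ← intervalIntegral.integral_of_le (by positivity),
      intervalIntegral.integral_eq_sub_of_hasDerivAt (fun r _ => hasDerivAt_comp_ray hf y θ r)
        (Continuous.intervalIntegrable (by fun_prop) _ _),
      eq_zero_of_le_norm hR hf.continuous hsupp, zero_smul, add_zero, zero_sub]
    have := norm_sub_norm_le ((2 * R) • (θ : E3)) (-y)
    rw [norm_smul, norm_coe_sphere, norm_neg, mul_one, sub_neg_eq_add,
      Real.norm_of_nonneg (by positivity), add_comm] at this
    linarith
  simp_rw [h6]
  rw [integral_const, sigma_real_univ, smul_eq_mul]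
  ring

end Divergence

/-! ### Assembling the inversion formulas -/

theorem divergence_of_eq_smul_radialField {R : ℝ} (hR : 0 < R) {f : E3 → ℝ}
    (hf : ContDiff ℝ 1 f) (hsupp : Function.support f ⊆ Metric.closedBall (0 : E3) R) {y : E3}
    (hy : ‖y‖ < R) {V : E3 → E3} {c : ℝ} (hV : ∀ x, ‖x‖ < R → V x = c • radialField R f x) :
    DifferentiableAt ℝ V y ∧ divergence V y = -(4 * Real.pi * c) * f y := by
  have hc : HasCompactSupport f :=
    HasCompactSupport.of_support_subset_isCompact (isCompact_closedBall _ _) hsupp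
  have hd := hasFDerivAt_radialField hf hc R y
  have h1 : HasFDerivAt V (c • fderiv ℝ (radialField R f) y) y := by
    refine (hd.differentiableAt.hasFDerivAt.const_smul c).congr_of_eventuallyEq ?_
    filter_upwards [Metric.isOpen_ball.mem_nhds (mem_ball_zero_iff.2 hy)] with x hx
    exact hV x (mem_ball_zero_iff.1 hx)
  refine ⟨h1.differentiableAt, ?_⟩
  have h2 := divergence_radialField hf hc hR hsupp hy
  have h3 : divergence V y = c * divergence (radialField R f) y := by
    simp only [divergence, h1.fderiv, Finset.mul_sum]
    rfl
  rw [h3, h2]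
  ring

theorem norm_sub_smul_sphere_pos {R : ℝ} (hR : 0 < R) {y : E3} (hy : ‖y‖ < R)
    (ω : Metric.sphere (0 : E3) 1) : 0 < ‖y - R • (ω : E3)‖ := by
  have := norm_sub_norm_le (R • (ω : E3)) y
  rw [norm_smul, norm_coe_sphere, mul_one, Real.norm_of_nonneg hR.le, norm_sub_rev] at this
  linarith

section Boundary

variable {R : ℝ} (hR : 0 < R) {f : E3 → ℝ} (hf : ContDiff ℝ 1 f)
  (hsupp : Function.support f ⊆ Metric.closedBall (0 : E3) R) {y : E3} (hy : ‖y‖ < R)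
include hR hf hsupp hy

/-- At z = Rω the inner normal is -ω and the area element contributes R²; the 4 undoes the
denominator 4t of the second derivative in the squared radius. With the factor -π/(2R²) from the
moment identity the total is 2π. -/
theorem boundary_integrand_eq (ω : Metric.sphere (0 : E3) 1) :
    R ^ 2 • (1 / ‖R • (ω : E3) - y‖ * quotDeriv (sphInt f (R • (ω : E3))) ‖R • (ω : E3) - y‖) •
      innerNormal R (R • (ω : E3)) =
    (-(4 * R ^ 2)) • ((sMean f (R • (ω : E3)) ‖y - R • (ω : E3)‖ +
        ‖y - R • (ω : E3)‖ * sMeanD f (R • (ω : E3)) ‖y - R • (ω : E3)‖) /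
        (4 * ‖y - R • (ω : E3)‖)) • (ω : E3) := by
  have hc : HasCompactSupport f :=
    HasCompactSupport.of_support_subset_isCompact (isCompact_closedBall _ _) hsupp
  have ht := norm_sub_smul_sphere_pos hR hy ω
  rw [norm_sub_rev, quotDeriv_eq hf hc _ ht, innerNormal]
  simp only [smul_smul]
  congr 1
  field_simp

theorem boundary_closed_form :
    BdryIntegrable R (fun z =>
      (1 / ‖z - y‖ * quotDeriv (sphInt f z) ‖z - y‖) • innerNormal R z) ∧
    bdryInt R (fun z => (1 / ‖z - y‖ * quotDeriv (sphInt f z) ‖z - y‖) • innerNormal R z) =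
      (2 * Real.pi) • radialField R f y := by
  have hc : HasCompactSupport f :=
    HasCompactSupport.of_support_subset_isCompact (isCompact_closedBall _ _) hsupp
  constructor
  · rw [BdryIntegrable]
    simp_rw [boundary_integrand_eq hR hf hsupp hy]
    refine integrable_sphere ?_
    have h0 : Continuous fun ω : Metric.sphere (0 : E3) 1 => ‖y - R • (ω : E3)‖ := by fun_prop
    have h1 : Continuous fun ω : Metric.sphere (0 : E3) 1 =>
        sMean f (R • (ω : E3)) ‖y - R • (ω : E3)‖ :=
      (continuous_sMean hf).comp (Continuous.prodMk (by fun_prop) h0)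
    have h2 : Continuous fun ω : Metric.sphere (0 : E3) 1 =>
        sMeanD f (R • (ω : E3)) ‖y - R • (ω : E3)‖ :=
      (continuous_sMeanD hf).comp (Continuous.prodMk (by fun_prop) h0)
    have h3 : Continuous fun ω : Metric.sphere (0 : E3) 1 => 4 * ‖y - R • (ω : E3)‖ := by fun_prop
    have h4 := (h1.add (h0.mul h2)).div h3 fun ω =>
      (mul_pos four_pos (norm_sub_smul_sphere_pos hR hy ω)).ne'
    exact (h4.smul continuous_subtype_val).const_smul (-(4 * R ^ 2))
  · rw [bdryInt]
    simp_rw [boundary_integrand_eq hR hf hsupp hy]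
    rw [integral_smul, integral_sphere_eq_radialField hf hc hsupp hy, smul_smul]
    congr 1
    field_simp
    ring

/-- The filtration is -2 times the closed-form integrand, so 2π becomes -4π; the factor -4π of the
divergence then gives 16π² here and -8π² for the closed form. -/
theorem boundary_filtration :
    BdryIntegrable R (fun z => filtration R (sphInt f z) ‖y - z‖ • innerNormal R z) ∧
    bdryInt R (fun z => filtration R (sphInt f z) ‖y - z‖ • innerNormal R z) =
      (-(4 * Real.pi)) • radialField R f y := by
  have h : ∀ ω : Metric.sphere (0 : E3) 1,
      R ^ 2 • filtration R (sphInt f (R • (ω : E3))) ‖y - R • (ω : E3)‖ •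
        innerNormal R (R • (ω : E3)) =
      (-2 : ℝ) • R ^ 2 • (1 / ‖R • (ω : E3) - y‖ *
        quotDeriv (sphInt f (R • (ω : E3))) ‖R • (ω : E3) - y‖) •
        innerNormal R (R • (ω : E3)) := fun ω => by
    have ht := norm_sub_smul_sphere_pos hR hy ω
    have hz : ‖R • (ω : E3)‖ = R := by
      rw [norm_smul, norm_coe_sphere, mul_one, Real.norm_of_nonneg hR.le]
    have h1 := (filterAbel_tendsto_and_integrable hR hf hsupp hz ht).2.1
    rw [filtration, h1.limUnder_eq, norm_sub_rev (R • (ω : E3)) y]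
    simp only [smul_smul]
    congr 1
    ring
  obtain ⟨h1, h2⟩ := boundary_closed_form hR hf hsupp hy
  rw [BdryIntegrable] at h1
  rw [bdryInt] at h2
  rw [BdryIntegrable, bdryInt]
  simp_rw [h]
  refine ⟨h1.smul (-2 : ℝ), ?_⟩
  rw [integral_smul, h2, smul_smul]
  congr 1
  ring

end Boundary

end SphMean

end

theorem mainTheorem2 (R : ℝ) (hR : 0 < R) (f : SphMean.E3 → ℝ) (hf : ContDiff ℝ 1 f)
    (hsupp : Function.support f ⊆ Metric.closedBall (0 : SphMean.E3) R) :
    -- the filtration step in closed form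
    (∀ z ∈ Metric.sphere (0 : SphMean.E3) R, ∀ t : ℝ, 0 < t →
      DifferentiableAt ℝ (fun s => SphMean.sphInt f z s / s) t ∧
      (∀ ε : ℝ, 0 < ε → IntegrableOn
        (fun l => Real.exp (-(ε * l)) * SphMean.filterIntegrand R (SphMean.sphInt f z) t l)
        (Ioi 0)) ∧
      Tendsto (SphMean.filterAbel R (SphMean.sphInt f z) t) (𝓝[>] 0)
        (𝓝 (SphMean.filtration R (SphMean.sphInt f z) t)) ∧
      SphMean.filtration R (SphMean.sphInt f z) t =
        -(2 / t) * SphMean.quotDeriv (SphMean.sphInt f z) t ∧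
      (∀ L : ℝ, Tendsto
        (fun Λ : ℝ => ∫ l in (0 : ℝ)..Λ, SphMean.filterIntegrand R (SphMean.sphInt f z) t l)
        atTop (𝓝 L) → SphMean.filtration R (SphMean.sphInt f z) t = L) ∧
      (ContDiff ℝ 2 f →
        IntegrableOn (SphMean.filterIntegrand R (SphMean.sphInt f z) t) (Ioi 0) ∧
        SphMean.filtration R (SphMean.sphInt f z) t =
          ∫ l in Ioi (0 : ℝ), SphMean.filterIntegrand R (SphMean.sphInt f z) t l)) ∧
    -- the inversion formula with the filtration step
    (∀ y ∈ Metric.ball (0 : SphMean.E3) R,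
      SphMean.BdryIntegrable R (fun z =>
        SphMean.filtration R (SphMean.sphInt f z) ‖y - z‖ • SphMean.innerNormal R z) ∧
      DifferentiableAt ℝ (fun x => SphMean.bdryInt R (fun z =>
        SphMean.filtration R (SphMean.sphInt f z) ‖x - z‖ • SphMean.innerNormal R z)) y ∧
      f y = 1 / (16 * Real.pi ^ 2) * SphMean.divergence (fun x => SphMean.bdryInt R (fun z =>
        SphMean.filtration R (SphMean.sphInt f z) ‖x - z‖ • SphMean.innerNormal R z)) y) ∧
    -- the inversion formula in closed form
    (∀ y ∈ Metric.ball (0 : SphMean.E3) R,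
      SphMean.BdryIntegrable R (fun z =>
        (1 / ‖z - y‖ * SphMean.quotDeriv (SphMean.sphInt f z) ‖z - y‖) •
          SphMean.innerNormal R z) ∧
      DifferentiableAt ℝ (fun x => SphMean.bdryInt R (fun z =>
        (1 / ‖z - x‖ * SphMean.quotDeriv (SphMean.sphInt f z) ‖z - x‖) •
          SphMean.innerNormal R z)) y ∧
      f y = -(1 / (8 * Real.pi ^ 2)) * SphMean.divergence (fun x => SphMean.bdryInt R (fun z =>
        (1 / ‖z - x‖ * SphMean.quotDeriv (SphMean.sphInt f z) ‖z - x‖) •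
          SphMean.innerNormal R z)) y) := by
  
  refine ⟨fun z hz t ht => ?_, fun y hy => ?_, fun y hy => ?_⟩
  · have hc : HasCompactSupport f :=
      HasCompactSupport.of_support_subset_isCompact (isCompact_closedBall _ _) hsupp
    obtain ⟨h1, h2, h3, h4⟩ :=
      SphMean.filterAbel_tendsto_and_integrable hR hf hsupp (mem_sphere_zero_iff_norm.1 hz) ht
    have h5 : SphMean.filtration R (SphMean.sphInt f z) t =
      -(2 / t) * SphMean.quotDeriv (SphMean.sphInt f z) t := h2.limUnder_eq
    refine ⟨(SphMean.hasDerivAt_sphInt_div hf hc z ht).differentiableAt, h1, by rwa [h5], h5,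
      fun L hL => h5.trans (tendsto_nhds_unique h2 (h3 L hL)), fun hf2 => ⟨h4 hf2, ?_⟩⟩
    exact h5.trans (tendsto_nhds_unique h2
      (h3 _ (intervalIntegral_tendsto_integral_Ioi 0 (h4 hf2) tendsto_id)))
  · rw [mem_ball_zero_iff] at hy
    obtain ⟨h1, h2⟩ := SphMean.divergence_of_eq_smul_radialField hR hf hsupp hy
      fun x hx => (SphMean.boundary_filtration hR hf hsupp hx).2
    refine ⟨(SphMean.boundary_filtration hR hf hsupp hy).1, h1, ?_⟩
    rw [h2]
    field_simp
    ring
  · rw [mem_ball_zero_iff] at hy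
    obtain ⟨h1, h2⟩ := SphMean.divergence_of_eq_smul_radialField hR hf hsupp hy
      fun x hx => (SphMean.boundary_closed_form hR hf hsupp hx).2
    refine ⟨(SphMean.boundary_closed_form hR hf hsupp hy).1, h1, ?_⟩
    rw [h2]
    field_simp
    ring
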